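/- Let $\Lambda$ be the ring of symmetric functions in $X=x_1+x_2+\cdots$ with coefficients in $\mathbb{Q}(t)$, with power sums $p_n$ and complete symmetric functions $h_r$ ($h_0=1$, and $h_r=0$ for $r<0$). Let $\langle\cdot,\cdot\rangle$ be the Hall scalar product, $\langle p_\lambda,p_\mu\rangle=\delta_{\lambda\mu}z_\lambda$, let $f^{\perp}$ be the adjoint of multiplication by $f$, and let $f\mapsto f[X(t-1)]$ be the $\mathbb{Q}(t)$-algebra endomorphism of $\Lambda$ with $p_n\mapsto(t^n-1)p_n$. For $m\in\mathbb{Z}$ put $$B_m=\sum_{i\ge 0} h_{i+m}\,\bigl(h_i[X(t-1)]\bigr)^{\perp},$$ and for a partition $\lambda$ with exactly $L$ positive parts put $$B_\lambda=\prod_{1\le a<b\le L}(1-t\,e_{ab})\;B_{\lambda_1}\cdots B_{\lambda_L},$$ where $e_{ab}$ acts on formal words $B_{v_1}\cdots B_{v_L}$ ($v\in\mathbb{Z}^L$) by raising $v_a$ by $1$ and lowering $v_b$ by $1$; $B_{\emptyset}$ is the identity. Let $k$ be a positive integer. The main hook-length of a non-empty partition $\lambda$ with $L$ positive parts is $\lambda_1+L-1$.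 The $k$-split of a partition $\lambda$ with $\lambda_1\le k$ is the sequence $(\lambda^{(1)},\dots,\lambda^{(r)})$ of non-empty partitions obtained by cutting the sequence of positive parts of $\lambda$ into consecutive blocks such that $\lambda^{(1)},\dots,\lambda^{(r-1)}$ have main hook-length exactly $k$ and $\lambda^{(r)}$ has main hook-length at most $k$. The $k$-split polynomial of $\lambda$ is $$G^{(k)}_\lambda=B_{\lambda^{(1)}}B_{\lambda^{(2)}}\cdots B_{\lambda^{(r)}}\cdot 1,\qquad G^{(k)}_{\emptyset}=1.$$ For an integer $0\le j\le k$ let $\Omega^{(k)}_j$ be the $\mathbb{Q}(t)$-linear span of the $G^{(k)}_\lambda$ over all partitions $\lambda$ with $\lambda_1=j$ (where $\lambda_1=0$ for the empty partition). **Theorem.** Let $0\le j\le k$ and $1\le \ell\le k$ be integers, and let $(\ell^{k+1-\ell})$ be the partition with $k+1-\ell$ parts equal to $\ell$. Then $B_{(\ell^{k+1-\ell})}f\in\Omega^{(k)}_{\max(j,\ell)}$ for all $f\in\Omega^{(k)}_j$. -/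

import Mathlib

open MvPolynomial

noncomputable section

namespace KSplit

/-! ### The ring of symmetric functions -/

/-- The ring `Λ` of symmetric functions with coefficients in a field `K` of characteristic zero,
written in terms of the power sums: it is the polynomial ring `K[p₁, p₂, …]`. -/
abbrev SymFun (K : Type*) [Field K] : Type _ := MvPolynomial ℕ+ K

/-- The power sum `pₙ`, `n ≥ 1`. For `m : ℕ+ →₀ ℕ`, the monomial `monomial m 1` is the power sum
`p_λ` of the partition `λ` that has `m n` parts equal to `n`. -/
abbrev p (K : Type*) [Field K] (n : ℕ+) : SymFun K := X n

/-- The complete symmetric functions `hₙ`, by Newton's identity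
`n hₙ = p₁ hₙ₋₁ + p₂ hₙ₋₂ + ⋯ + pₙ h₀`, with `h₀ = 1`. -/
def hNat (K : Type*) [Field K] : ℕ → SymFun K
  | 0 => 1
  | n + 1 => C ((n + 1 : K)⁻¹) * ∑ i : Fin (n + 1), p K (Nat.succPNat i) * hNat K (n - i)

/-- The functions `hᵣ = sᵣ` for `r : ℤ`, with `hᵣ = 0` for `r < 0`. -/
def h (K : Type*) [Field K] (r : ℤ) : SymFun K :=
  if 0 ≤ r then hNat K r.toNat else 0

/-- The value `f(x₁, …, x_N)` of a symmetric function in `N` variables. -/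
def realize (K : Type*) [Field K] (N : ℕ) : SymFun K →ₐ[K] MvPolynomial (Fin N) K :=
  aeval fun n => psum (Fin N) K n

theorem coeff_hsymm (K : Type*) [Field K] (N n : ℕ) (m : Fin N →₀ ℕ) :
    coeff m (hsymm (Fin N) K n) = if m.degree = n then 1 else 0 := by
  classical
  have key : ∀ s : Sym (Fin N) n,
      ((s.1.map X).prod : MvPolynomial (Fin N) K) = monomial (Multiset.toFinsupp s.1) 1 := by
    intro s
    generalize s.1 = t
    induction t using Multiset.induction with
    | empty => simp
    | cons a t ih =>
      rw [Multiset.map_cons, Multiset.prod_cons, ih, ← Multiset.singleton_add, map_add,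
        Multiset.toFinsupp_singleton, X, monomial_mul, one_mul]
  have hdeg : ∀ t : Multiset (Fin N), (Multiset.toFinsupp t).degree = t.card := by
    intro t
    induction t using Multiset.induction with
    | empty => simp
    | cons a t ih =>
      rw [← Multiset.singleton_add, map_add, Multiset.toFinsupp_singleton, map_add, ih]
      simp [add_comm]
  simp only [hsymm, coeff_sum, key, coeff_monomial]
  split_ifs with hm
  · have hc : (Finsupp.toMultiset m).card = n := by
      rw [← hdeg, Finsupp.toMultiset_toFinsupp, hm]
    refine (Finset.sum_eq_single (⟨Finsupp.toMultiset m, hc⟩ : Sym (Fin N) n) ?_ ?_).trans ?_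
    · intro b _ hb
      rw [if_neg]
      rintro rfl
      apply hb
      apply Subtype.ext
      simp
    · exact fun hh => absurd (Finset.mem_univ (α := Sym (Fin N) n) _) hh
    · simp
  · apply Finset.sum_eq_zero
    intro s _
    rw [if_neg]
    rintro rfl
    exact hm (by rw [hdeg]; exact s.2)

theorem newton_hsymm (K : Type*) [Field K] (N n : ℕ) :
    (n + 1 : MvPolynomial (Fin N) K) * hsymm (Fin N) K (n + 1) =
      ∑ i : Fin (n + 1), psum (Fin N) K (i + 1) * hsymm (Fin N) K (n - i) := by
  classical
  ext m
  have e : (n + 1 : MvPolynomial (Fin N) K) = C (n + 1 : K) := by simp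
  rw [e, coeff_C_mul, coeff_hsymm, Fin.sum_univ_eq_sum_range
    (fun i => psum (Fin N) K (i + 1) * hsymm (Fin N) K (n - i)) (n + 1)]
  simp only [psum, Finset.sum_mul, coeff_sum, X_pow_eq_monomial, coeff_monomial_mul', coeff_hsymm,
    one_mul]
  rw [Finset.sum_comm]
  have hterm : ∀ x : Fin N, ∀ i ∈ Finset.range (n + 1),
      (if Finsupp.single x (i + 1) ≤ m then
        (if (m - Finsupp.single x (i + 1)).degree = n - i then (1 : K) else 0) else 0) =
      if m.degree = n + 1 ∧ i < m x then 1 else 0 := by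
    intro x i hi
    rw [Finset.mem_range] at hi
    by_cases hx : i < m x
    · have hle : Finsupp.single x (i + 1) ≤ m := by
        rw [Finsupp.single_le_iff]; exact hx
      have hd : (m - Finsupp.single x (i + 1)).degree + (i + 1) = m.degree := by
        conv_rhs => rw [← tsub_add_cancel_of_le hle, map_add, Finsupp.degree_single]
      rw [if_pos hle]
      congr 1
      simp only [hx, and_true, eq_iff_iff]
      omega
    · rw [if_neg, if_neg]
      · exact fun hh => hx hh.2
      · rw [Finsupp.single_le_iff]; omega
  rw [Finset.sum_congr rfl fun x _ => Finset.sum_congr rfl (hterm x)]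
  split_ifs with hm
  · have hcount : ∀ x : Fin N, (∑ i ∈ Finset.range (n + 1),
        if m.degree = n + 1 ∧ i < m x then (1 : K) else 0) = (m x : K) := by
      intro x
      have hx : m x ≤ n + 1 := hm ▸ Finsupp.le_degree x m
      rw [Finset.sum_boole]
      congr 1
      have : (Finset.range (n + 1)).filter (fun i => m.degree = n + 1 ∧ i < m x) =
          Finset.range (m x) := by
        ext i; simp only [Finset.mem_filter, Finset.mem_range]; omega
      rw [this, Finset.card_range]
    rw [Finset.sum_congr rfl fun x _ => hcount x, ← Nat.cast_sum, ← Finsupp.degree_eq_sum, hm]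
    simp
  · simp [hm]

/-- `hₙ` is the complete symmetric function: its value in `N` variables is the sum of all
monomials of degree `n`. -/
theorem realize_hNat (K : Type*) [Field K] [CharZero K] (N n : ℕ) :
    realize K N (hNat K n) = hsymm (Fin N) K n := by
  induction n using Nat.strong_induction_on with
  | _ n ih =>
    cases n with
    | zero => simp [hNat]
    | succ n =>
      have hn : (n + 1 : K) ≠ 0 := by exact_mod_cast Nat.succ_ne_zero n
      have hs : realize K N (∑ i : Fin (n + 1), p K (Nat.succPNat i) * hNat K (n - i)) =
          (n + 1 : MvPolynomial (Fin N) K) * hsymm (Fin N) K (n + 1) := by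
        rw [newton_hsymm, map_sum]
        refine Finset.sum_congr rfl fun i _ => ?_
        rw [map_mul, ih _ (by omega), realize, aeval_X, Nat.succPNat_coe]
      have hC : realize K N (C ((n + 1 : K)⁻¹)) = C ((n + 1 : K)⁻¹) := by
        simp [realize]
      have e : (n + 1 : MvPolynomial (Fin N) K) = C (n + 1 : K) := by simp
      rw [hNat, map_mul, hs, hC, e, ← mul_assoc, ← C_mul, inv_mul_cancel₀ hn, C_1, one_mul]

/-! ### The scalar product and adjoint operators -/

/-- `z_λ = ∏ n^{mₙ} mₙ!` for the partition `λ` with `mₙ` parts equal to `n`. -/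
def z (K : Type*) [Field K] (m : ℕ+ →₀ ℕ) : K :=
  m.prod fun n c => ((n : ℕ) : K) ^ c * (c.factorial : K)

/-- The Hall scalar product: the bilinear form with `⟨p_λ, p_μ⟩ = δ_{λμ} z_λ`. -/
def hall (K : Type*) [Field K] : SymFun K →ₗ[K] SymFun K →ₗ[K] K :=
  (basisMonomials ℕ+ K).constr K fun m => z K m • lcoeff K m

/-- The operator `f^⊥` on `Λ`, adjoint to multiplication by `f` (see `hall_perp`). The coefficient
of `p^m` in `f^⊥ p^n` is `⟨p^n, f p^m⟩ / z_m`, which is zero unless `m ≤ n`. -/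
def perp {K : Type*} [Field K] (f : SymFun K) : SymFun K →ₗ[K] SymFun K :=
  (basisMonomials ℕ+ K).constr K fun n =>
    ∑ m ∈ Finset.Iic n,
      monomial m (hall K (monomial n 1) (f * monomial m 1) / z K m)

theorem z_ne_zero (K : Type*) [Field K] [CharZero K] (m : ℕ+ →₀ ℕ) : z K m ≠ 0 := by
  rw [z, Finsupp.prod, Finset.prod_ne_zero_iff]
  intro n _
  exact mul_ne_zero (pow_ne_zero _ (by exact_mod_cast n.ne_zero))
    (by exact_mod_cast Nat.factorial_ne_zero _)

theorem hall_monomial_left {K : Type*} [Field K] (m : ℕ+ →₀ ℕ) (g : SymFun K) :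
    hall K (monomial m 1) g = z K m * coeff m g := by
  have := (basisMonomials ℕ+ K).constr_basis K (fun m => z K m • lcoeff K m) m
  rw [coe_basisMonomials] at this
  rw [hall, this]
  rfl

theorem hall_monomial {K : Type*} [Field K] (m n : ℕ+ →₀ ℕ) :
    hall K (monomial m 1) (monomial n 1) = if m = n then z K m else 0 := by
  classical
  rw [hall_monomial_left, coeff_monomial]
  by_cases hmn : m = n
  · simp [hmn]
  · simp [hmn, Ne.symm hmn]

theorem perp_monomial {K : Type*} [Field K] (f : SymFun K) (n : ℕ+ →₀ ℕ) :
    perp f (monomial n 1) = ∑ m ∈ Finset.Iic n,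
      monomial m (hall K (monomial n 1) (f * monomial m 1) / z K m) := by
  have := (basisMonomials ℕ+ K).constr_basis K (fun n => ∑ m ∈ Finset.Iic n,
      monomial m (hall K (monomial n 1) (f * monomial m 1) / z K m)) n
  rw [coe_basisMonomials] at this
  exact this

/-- The defining property `⟨f^⊥ g, u⟩ = ⟨g, f u⟩` of `f^⊥`. -/
theorem hall_perp {K : Type*} [Field K] [CharZero K] (f g u : SymFun K) :
    hall K (perp f g) u = hall K g (f * u) := by
  classical
  have key : (hall K).comp (perp f) = (LinearMap.mulLeft K f).lcomp K K ∘ₗ (hall K) := by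
    refine (basisMonomials ℕ+ K).ext fun n => (basisMonomials ℕ+ K).ext fun l => ?_
    simp only [coe_basisMonomials, LinearMap.comp_apply, LinearMap.lcomp_apply,
      LinearMap.mulLeft_apply]
    rw [perp_monomial, map_sum, LinearMap.sum_apply]
    have hterm : ∀ m : ℕ+ →₀ ℕ,
        hall K (monomial m (hall K (monomial n 1) (f * monomial m 1) / z K m)) (monomial l 1) =
          if m = l then hall K (monomial n 1) (f * monomial l 1) else 0 := by
      intro m
      rw [← mul_one (hall K (monomial n 1) (f * monomial m 1) / z K m), ← smul_eq_mul,
        ← smul_monomial, map_smul, LinearMap.smul_apply, hall_monomial]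
      split_ifs with hml
      · subst hml
        rw [smul_eq_mul, div_mul_cancel₀ _ (z_ne_zero K m)]
      · simp
    rw [Finset.sum_congr rfl fun m _ => hterm m, Finset.sum_ite_eq']
    split_ifs with hl
    · rfl
    · rw [Finset.mem_Iic] at hl
      rw [hall_monomial_left, coeff_mul_monomial', if_neg hl, mul_zero]
  have := LinearMap.congr_fun (LinearMap.congr_fun key g) u
  simpa using this

/-- The Hall scalar product is nondegenerate, so that `hall_perp` determines `f^⊥`. -/
theorem eq_of_hall_eq {K : Type*} [Field K] [CharZero K] (f g : SymFun K)
    (hfg : ∀ u, hall K u f = hall K u g) : f = g := by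
  ext m
  have := hfg (monomial m 1)
  rw [hall_monomial_left, hall_monomial_left] at this
  exact mul_left_cancel₀ (z_ne_zero K m) this

/-! ### Vertex operators -/

/-- The plethysm `f ↦ f[X(t-1)]`, that is `pₙ ↦ (tⁿ - 1) pₙ`. -/
def pleth {K : Type*} [Field K] (t : K) : SymFun K →ₐ[K] SymFun K :=
  aeval fun n => C (t ^ (n : ℕ) - 1) * p K n

theorem isWeightedHomogeneous_hNat (K : Type*) [Field K] (n : ℕ) :
    IsWeightedHomogeneous (fun i : ℕ+ => (i : ℕ)) (hNat K n) n := by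
  induction n using Nat.strong_induction_on with
  | _ n ih =>
    cases n with
    | zero => rw [hNat]; exact isWeightedHomogeneous_one _ _
    | succ n =>
      rw [hNat, ← zero_add (n + 1)]
      refine (isWeightedHomogeneous_C _ _).mul (IsWeightedHomogeneous.sum _ _ _ fun i _ => ?_)
      have h1 := (isWeightedHomogeneous_X K (fun i : ℕ+ => (i : ℕ)) (Nat.succPNat i)).mul
        (ih (n - i) (by omega))
      rw [Nat.succPNat_coe] at h1
      have h2 : (i : ℕ).succ + (n - i) = n + 1 := by omega
      rwa [h2] at h1

theorem pleth_monomial {K : Type*} [Field K] (t : K) (m : ℕ+ →₀ ℕ) (c : K) :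
    ∃ d : K, pleth t (monomial m c) = monomial m d := by
  refine ⟨c * m.prod fun n e => (t ^ (n : ℕ) - 1) ^ e, ?_⟩
  rw [pleth, aeval_monomial, monomial_eq, C_mul, mul_assoc, algebraMap_eq]
  congr 1
  simp only [mul_pow, Finsupp.prod_mul]
  congr 1
  simp only [Finsupp.prod, map_prod, map_pow]

theorem isWeightedHomogeneous_pleth {K : Type*} [Field K] (t : K) {f : SymFun K} {n : ℕ}
    (hf : IsWeightedHomogeneous (fun i : ℕ+ => (i : ℕ)) f n) :
    IsWeightedHomogeneous (fun i : ℕ+ => (i : ℕ)) (pleth t f) n := by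
  rw [f.as_sum, map_sum]
  refine IsWeightedHomogeneous.sum _ _ _ fun m hm => ?_
  obtain ⟨d, hd⟩ := pleth_monomial t m (coeff m f)
  rw [hd]
  exact isWeightedHomogeneous_monomial _ _ _ (hf (mem_support_iff.mp hm))

theorem perp_monomial_eq_zero {K : Type*} [Field K] {f : SymFun K} {i : ℕ}
    (hf : IsWeightedHomogeneous (fun i : ℕ+ => (i : ℕ)) f i) (n : ℕ+ →₀ ℕ)
    (hi : Finsupp.weight (fun i : ℕ+ => (i : ℕ)) n < i) : perp f (monomial n 1) = 0 := by
  classical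
  rw [perp_monomial]
  refine Finset.sum_eq_zero fun m hm => ?_
  rw [Finset.mem_Iic] at hm
  have : coeff (n - m) f = 0 := by
    by_contra hc
    have h1 := hf hc
    have h2 : Finsupp.weight (fun i : ℕ+ => (i : ℕ)) n =
        Finsupp.weight (fun i : ℕ+ => (i : ℕ)) (n - m) +
          Finsupp.weight (fun i : ℕ+ => (i : ℕ)) m := by
      rw [← map_add, tsub_add_cancel_of_le hm]
    omega
  rw [hall_monomial_left, coeff_mul_monomial', if_pos hm, this]
  simp

/-- The sum that defines `B_ℓ` is finite on each symmetric function. -/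
theorem vertex_finite {K : Type*} [Field K] (t : K) (ℓ : ℤ) (f : SymFun K) :
    (Function.support fun i : ℕ => h K (i + ℓ) * perp (pleth t (h K i)) f).Finite := by
  have hperp : ∀ i : ℕ, (∀ n ∈ f.support, Finsupp.weight (fun i : ℕ+ => (i : ℕ)) n < i) →
      perp (pleth t (h K i)) f = 0 := by
    intro i hi
    conv_lhs => rw [f.as_sum]
    rw [map_sum]
    refine Finset.sum_eq_zero fun n hn => ?_
    rw [← mul_one (coeff n f), ← smul_eq_mul, ← smul_monomial, map_smul,
      perp_monomial_eq_zero (i := i) ?_ n (hi n hn), smul_zero]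
    apply isWeightedHomogeneous_pleth
    simpa [h] using isWeightedHomogeneous_hNat K i
  refine (Finset.range (f.support.sup (Finsupp.weight (fun i : ℕ+ => (i : ℕ))) + 1)).finite_toSet
    |>.subset fun i hi => ?_
  by_contra hlt
  simp only [Finset.coe_range, Set.mem_Iio, not_lt] at hlt
  refine hi ?_
  change _ * _ = 0
  rw [hperp i fun n hn => lt_of_lt_of_le (Nat.lt_succ_of_le
    (Finset.le_sup (f := Finsupp.weight (fun i : ℕ+ => (i : ℕ))) hn)) hlt, mul_zero]

/-- The vertex operator `B_ℓ = ∑_{i ≥ 0} s_{i+ℓ}[X] s_i[X(t-1)]^⊥`, `ℓ ∈ ℤ`. -/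
def vertex {K : Type*} [Field K] (t : K) (ℓ : ℤ) : Module.End K (SymFun K) where
  toFun f := ∑ᶠ i : ℕ, h K (i + ℓ) * perp (pleth t (h K i)) f
  map_add' f g := by
    rw [← finsum_add_distrib (vertex_finite t ℓ f) (vertex_finite t ℓ g)]
    simp only [map_add, mul_add]
  map_smul' c f := by
    rw [RingHom.id_apply, smul_finsum' c (vertex_finite t ℓ f)]
    simp only [map_smul, mul_smul_comm]

/-- The composition `B_{v₁} B_{v₂} ⋯ B_{v_L}`. -/
def word {K : Type*} [Field K] (t : K) {L : ℕ} (v : Fin L → ℤ) : Module.End K (SymFun K) :=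
  (List.ofFn fun i => vertex t (v i)).prod

/-- The expression `∏_{i<j} (1 - t e_{ij})` in the group algebra of `ℤ^L`, where the formal
symbol `B_{v₁} ⋯ B_{v_L}` is written `single v 1`, so that `e_{ij}`, which adds `1` to `vᵢ` and
subtracts `1` from `vⱼ`, is the multiplication by `single (εᵢ - εⱼ) 1`. -/
def raising {K : Type*} [Field K] (t : K) (L : ℕ) : AddMonoidAlgebra K (Fin L → ℤ) :=
  ∏ q : Fin L × Fin L with q.1 < q.2,
    (1 - AddMonoidAlgebra.single (Pi.single q.1 1 - Pi.single q.2 1) t)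

/-- The operator `B_v = ∏_{i<j} (1 - t e_{ij}) B_{v₁} ⋯ B_{v_L}` of an integer vector `v`. -/
def vertexVec {K : Type*} [Field K] (t : K) {L : ℕ} (v : Fin L → ℤ) :
    Module.End K (SymFun K) :=
  (raising t L * AddMonoidAlgebra.single v 1).coeff.sum fun w c => c • word t w

/-! ### Partitions and the polynomials `G` -/

/-- A partition is the weakly decreasing list of its (positive) parts. -/
def IsPartition (l : List ℕ) : Prop := l.Pairwise (· ≥ ·) ∧ ∀ x ∈ l, 0 < x

/-- The first part `λ₁`, which is `0` for the empty partition. -/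
def firstPart (l : List ℕ) : ℕ := l.headD 0

/-- The main hook-length `h_M(λ) = λ₁ + ℓ(λ) - 1` (and `0` for the empty partition). -/
def mainHook (l : List ℕ) : ℕ := firstPart l + l.length - 1

/-- The operator `B_λ` of a partition `λ` of length `L`; it is the identity for `L = 0`. -/
def vertexPart {K : Type*} [Field K] (t : K) (l : List ℕ) : Module.End K (SymFun K) :=
  vertexVec t fun i : Fin l.length => (l.get i : ℤ)

/-- The `k`-split `(λ⁽¹⁾, λ⁽²⁾, …)` of a `k`-bounded partition `λ`: `λ⁽¹⁾` consists of the first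
`k + 1 - λ₁` parts (or of all parts, if there are fewer), and one goes on with the other parts.
See `kSplit_flatten` and `kSplit_mainHook`. -/
def kSplit (k : ℕ) : List ℕ → List (List ℕ)
  | [] => []
  | a :: l => (a :: l.take (k - a)) :: kSplit k (l.drop (k - a))
termination_by l => l.length
decreasing_by simp only [List.length_drop, List.length_cons]; omega

theorem kSplit_flatten (k : ℕ) (l : List ℕ) : (kSplit k l).flatten = l := by
  induction l using kSplit.induct k with
  | case1 => simp [kSplit]
  | case2 a l ih => rw [kSplit, List.flatten_cons, ih]; simp

/-- All blocks of the `k`-split are non-empty with main hook-length at most `k`, and all blocks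
but the last one have main hook-length equal to `k`. -/
theorem kSplit_mainHook (k : ℕ) (l : List ℕ) (hl : ∀ x ∈ l, x ≤ k) :
    (∀ b ∈ kSplit k l, b ≠ [] ∧ mainHook b ≤ k) ∧
      ∀ b ∈ (kSplit k l).dropLast, mainHook b = k := by
  induction l using kSplit.induct k with
  | case1 => simp [kSplit]
  | case2 a l ih =>
    have ha : a ≤ k := hl a (by simp)
    obtain ⟨h1, h2⟩ := ih fun x hx => hl x (List.mem_cons_of_mem _ (List.mem_of_mem_drop hx))
    rw [kSplit]
    constructor
    · intro b hb
      rcases List.mem_cons.mp hb with rfl | hb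
      · refine ⟨by simp, ?_⟩
        simp only [mainHook, firstPart, List.headD_cons, List.length_cons, List.length_take]
        omega
      · exact h1 b hb
    · intro b hb
      by_cases hd : l.drop (k - a) = []
      · rw [hd] at hb
        simp [kSplit] at hb
      · have hne : kSplit k (l.drop (k - a)) ≠ [] := by
          intro h0
          apply hd
          rw [← kSplit_flatten k (l.drop (k - a)), h0, List.flatten_nil]
        rw [List.dropLast_cons_of_ne_nil hne] at hb
        rcases List.mem_cons.mp hb with rfl | hb
        · have hlen : k - a < l.length := by
            by_contra hc
            exact hd (List.drop_eq_nil_of_le (not_lt.mp hc))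
          simp only [mainHook, firstPart, List.headD_cons, List.length_cons, List.length_take]
          omega
        · exact h2 b hb

/-- The `k`-split polynomial `G_λ^{(k)} = B_{λ⁽¹⁾} B_{λ⁽²⁾} ⋯ 1` of a `k`-bounded partition. -/
def splitPoly {K : Type*} [Field K] (t : K) (k : ℕ) (l : List ℕ) : SymFun K :=
  (kSplit k l).foldr (fun b f => vertexPart t b f) 1

/-- `Ω_j^{(k)}`, for `j ≤ k`: the span of the `G_λ^{(k)}` for the partitions `λ` with `λ₁ = j`. -/
def Omega {K : Type*} [Field K] (t : K) (k j : ℕ) : Submodule K (SymFun K) :=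
  Submodule.span K {g | ∃ l : List ℕ, IsPartition l ∧ firstPart l = j ∧ g = splitPoly t k l}

end KSplit

end

noncomputable section

namespace KSplit

variable {K : Type*} [Field K]

/-! ### The adjoint of a power sum -/

/-! The engine is that `B_v` is alternating in the shifted entries `v_i - i` (`vertexAlt_comp`), so
that it vanishes when two of them coincide and is otherwise, up to sign, `B` of a weakly decreasing
vector. Adjacent transpositions reduce this to two entries. There `B_{(a,b)}` and `-B_{(b-1,a+1)}`
obey the same commutation rule with each `p_n`, and they agree on `1` because `B_{(a,b)} · 1 = h_a
h_b - h_{a+1} h_{b-1}`.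

Let `R = (ℓ^{k+1-ℓ})`, which has main hook-length `k`. If `λ₁ ≤ ℓ`, then `R` is simply a new first
block of the `k`-split, and `B_R G_λ` is the polynomial of `R` followed by `λ`. The content lies in
the case `λ₁ = j > ℓ`, where `R` must be moved past the first block `μ`, which has `n = k+1-j` parts
(after padding with zeros if it is the last block). Put `q = j - ℓ`, so that `R = (ℓ^n, ℓ^q)`. By
`rectangle_mul_vertexVec`, the product `B_R B_μ` is a sum over 0-1 matrices of products `B_{ℓ^n +
row sums} B_{(ℓ^q - column sums, μ)}`; the unwanted terms have a repeated shifted entry.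

By alternation this sum is a functional of `∏ (w_j - t u_i) u^δ w^δ`. Antisymmetrizing turns that
polynomial into a multiple of the Vandermonde determinant in all the variables `t u_i, w_j`.
Expanding the determinant leaves only terms indexed by permutations `π` of `0, …, n+q-1`
(`sum_weight_mem`, `rectangle_vertexVec_mem`). In each nonzero term the left factor sorts to a
partition with first part `j` and `n` parts, and the right factor to one with first part `ℓ` and `n
+ q = k+1-ℓ` parts, so both have main hook-length `k`. The right factor is either absorbed as a
block or is `±B_R` itself, acting on the remaining blocks; induction on the number of parts finishes
the proof (`rectangle_mem_Omega_of_lt`, `rectangle_splitPoly_mem`). -/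

theorem hall_symm (f g : SymFun K) : hall K f g = hall K g f := by
  have key : hall K = (hall K).flip := by
    refine (basisMonomials ℕ+ K).ext fun n => (basisMonomials ℕ+ K).ext fun l => ?_
    simp only [coe_basisMonomials, LinearMap.flip_apply, hall_monomial]
    by_cases hnl : n = l
    · simp [hnl]
    · simp [hnl, Ne.symm hnl]
  exact LinearMap.congr_fun (LinearMap.congr_fun key f) g

/-- By nondegeneracy, every identity for `f^⊥` below can be checked after pairing with an arbitrary
`u`. -/
theorem perp_unique [CharZero K] {f g g' : SymFun K}
    (H : ∀ u, hall K g' u = hall K g (f * u)) : perp f g = g' :=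
  eq_of_hall_eq _ _ fun u => by rw [hall_symm, hall_perp, hall_symm u, H]

theorem perp_mul [CharZero K] (f g x : SymFun K) : perp (f * g) x = perp f (perp g x) :=
  perp_unique fun u => by rw [hall_perp, hall_perp, mul_left_comm, mul_assoc]

theorem perp_one [CharZero K] (x : SymFun K) : perp 1 x = x :=
  perp_unique fun u => by rw [one_mul]

theorem perp_zero [CharZero K] (x : SymFun K) : perp (0 : SymFun K) x = 0 :=
  perp_unique fun u => by simp

theorem perp_C_mul [CharZero K] (c : K) (f x : SymFun K) : perp (C c * f) x = c • perp f x :=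
  perp_unique fun u => by
    rw [map_smul, LinearMap.smul_apply, hall_perp, mul_assoc, C_mul', map_smul]

theorem perp_sum [CharZero K] {ι : Type*} (s : Finset ι) (f : ι → SymFun K) (x : SymFun K) :
    perp (∑ i ∈ s, f i) x = ∑ i ∈ s, perp (f i) x :=
  perp_unique fun u => by
    rw [map_sum, LinearMap.sum_apply, Finset.sum_mul, map_sum]
    exact Finset.sum_congr rfl fun i _ => hall_perp _ _ _

theorem z_add_single (b : ℕ+ →₀ ℕ) (n : ℕ+) :
    z K (b + Finsupp.single n 1) = ((n : ℕ) : K) * ((b n : K) + 1) * z K b := by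
  classical
  have e1 : ∀ m : ℕ+ →₀ ℕ, m.support ⊆ insert n b.support → z K m =
      ∏ i ∈ insert n b.support, ((i : ℕ) : K) ^ (m i) * ((m i).factorial : K) := fun m hm =>
    Finsupp.prod_of_support_subset _ hm _ (by simp)
  rw [e1 b (Finset.subset_insert _ _), e1 (b + Finsupp.single n 1),
    ← Finset.mul_prod_erase _ _ (Finset.mem_insert_self n _),
    ← Finset.mul_prod_erase _ _ (Finset.mem_insert_self n _), ← mul_assoc]
  · congr 1
    · simp only [Finsupp.add_apply, Finsupp.single_eq_same, pow_succ, Nat.factorial_succ]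
      push_cast
      ring
    · refine Finset.prod_congr rfl fun i hi => ?_
      rw [Finsupp.add_apply, Finsupp.single_eq_of_ne (Finset.ne_of_mem_erase hi), add_zero]
  · intro i hi
    by_cases hin : i = n
    · simp [hin]
    · simp only [Finsupp.mem_support_iff, Finsupp.add_apply, Finsupp.single_eq_of_ne hin,
        add_zero] at hi
      simp [hi]

/-- On monomials this is the relation `z_{b + e_n} = n (b_n + 1) z_b`. -/
theorem perp_p [CharZero K] (n : ℕ+) (g : SymFun K) :
    perp (p K n) g = ((n : ℕ) : K) • pderiv n g := by
  classical
  refine perp_unique fun u => ?_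
  have key : (hall K) ∘ₗ (((n : ℕ) : K) • (pderiv n : Derivation K (SymFun K) (SymFun K)).toLinearMap)
      = (LinearMap.mulLeft K (p K n)).lcomp K K ∘ₗ (hall K) := by
    refine (basisMonomials ℕ+ K).ext fun a => (basisMonomials ℕ+ K).ext fun b => ?_
    simp only [coe_basisMonomials, LinearMap.comp_apply, LinearMap.lcomp_apply,
      LinearMap.mulLeft_apply, LinearMap.smul_apply, Derivation.coeFn_coe, pderiv_monomial, one_mul,
      map_smul]
    have e2 : p K n * monomial b 1 = monomial (b + Finsupp.single n 1) 1 := by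
      rw [p, X, monomial_mul, one_mul, add_comm]
    rw [e2, hall_monomial, ← mul_one ((a n : K)), ← smul_eq_mul, ← smul_monomial, map_smul,
      LinearMap.smul_apply, hall_monomial]
    by_cases han : a n = 0
    · rw [if_neg (c := a = b + Finsupp.single n 1)]
      · simp [han]
      · rintro rfl
        simp at han
    · have hle : Finsupp.single n 1 ≤ a := by rw [Finsupp.single_le_iff]; omega
      have hiff : a - Finsupp.single n 1 = b ↔ a = b + Finsupp.single n 1 := by
        constructor
        · rintro rfl; rw [tsub_add_cancel_of_le hle]
        · rintro rfl; simp
      simp only [hiff]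
      split_ifs with hab
      · subst hab
        rw [z_add_single]
        simp
        ring
      · simp
  exact LinearMap.congr_fun (LinearMap.congr_fun key g) u

/-! ### Newton's identity -/

theorem h_of_neg {r : ℤ} (hr : r < 0) : h K r = 0 := by rw [h, if_neg (by omega)]

theorem h_natCast (n : ℕ) : h K n = hNat K n := by simp [h]

theorem h_zero : h K 0 = 1 := by simp [h, hNat]

/-- The upper limit `N` is free because `h` vanishes at negative indices; Newton's identities for
different `i` can then be summed over one common range. -/
theorem newton_h [CharZero K] (i : ℤ) (N : ℕ) (hN : i ≤ N) :
    C (i : K) * h K i = ∑ r ∈ Finset.range N, p K r.succPNat * h K (i - 1 - r) := by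
  rcases lt_or_ge i 1 with hi | hi
  · rw [Finset.sum_eq_zero fun r _ => by rw [h_of_neg (by omega), mul_zero]]
    rcases eq_or_ne i 0 with rfl | h0
    · simp
    · rw [h_of_neg (by omega), mul_zero]
  · obtain ⟨n, rfl⟩ : ∃ n : ℕ, i = ((n + 1 : ℕ) : ℤ) := ⟨(i - 1).toNat, by omega⟩
    have hle : n + 1 ≤ N := by omega
    rw [← Finset.sum_subset (Finset.range_mono hle), h_natCast, hNat, ← mul_assoc, ← C_mul]
    · have hn : (n + 1 : K) ≠ 0 := by exact_mod_cast Nat.succ_ne_zero n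
      push_cast
      rw [mul_inv_cancel₀ hn, C_1, one_mul, Fin.sum_univ_eq_sum_range
        (fun i => p K (Nat.succPNat i) * hNat K (n - i)) (n + 1)]
      refine Finset.sum_congr rfl fun r hr => ?_
      rw [Finset.mem_range] at hr
      rw [show ((n : ℤ) + 1 - 1 - r) = ((n - r : ℕ) : ℤ) by omega, h_natCast]
    · intro r _ hr
      rw [Finset.mem_range] at hr
      rw [h_of_neg (by omega), mul_zero]

theorem pderiv_p (r n : ℕ+) (f : SymFun K) :
    pderiv r (p K n * f) = (if r = n then f else 0) + p K n * pderiv r f := by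
  classical
  rw [Derivation.leibniz, pderiv_X, smul_eq_mul, smul_eq_mul, Pi.single_apply]
  by_cases hrn : n = r
  · simp [hrn, add_comm]
  · simp [hrn, Ne.symm hrn]

/-- Differentiating Newton's identity for `h_b`, the term with `p_n` gives `n h_{b-n}`, and the
others reassemble by induction into Newton's identity for `h_{b-n}`, that is `(b-n) h_{b-n}`. The
total is `b h_{b-n}`. -/
theorem pderiv_h [CharZero K] (n : ℕ+) (b : ℤ) :
    ((n : ℕ) : K) • pderiv n (h K b) = h K (b - n) := by
  rcases lt_or_ge b 0 with hb | hb
  · rw [h_of_neg hb, h_of_neg (by have := n.pos; omega), map_zero, smul_zero]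
  obtain ⟨m, rfl⟩ := Int.eq_ofNat_of_zero_le hb
  clear hb
  induction m using Nat.strong_induction_on with
  | _ m ih =>
    rcases Nat.eq_zero_or_pos m with rfl | hm
    · have := n.pos
      rw [Nat.cast_zero, h_zero, h_of_neg (by omega), Derivation.map_one_eq_zero, smul_zero]
    have hm0 : (m : K) ≠ 0 := by exact_mod_cast hm.ne'
    apply smul_right_injective (SymFun K) hm0
    simp only
    have N1 := newton_h (K := K) (m : ℤ) m le_rfl
    have N2 := newton_h (K := K) ((m : ℤ) - n) m (by omega)
    have e1 : (m : K) • ((n : ℕ) : K) • pderiv n (h K (m : ℤ)) =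
        ((n : ℕ) : K) • pderiv n (C ((m : ℤ) : K) * h K (m : ℤ)) := by
      rw [C_mul', Derivation.map_smul, smul_comm]; simp
    rw [e1, N1, map_sum, Finset.smul_sum]
    have e2 : ∀ r ∈ Finset.range m,
        ((n : ℕ) : K) • pderiv n (p K r.succPNat * h K ((m : ℤ) - 1 - r)) =
        ((n : ℕ) : K) • (if n = r.succPNat then h K ((m : ℤ) - n) else 0) +
          p K r.succPNat * h K ((m : ℤ) - n - 1 - r) := by
      intro r hr
      rw [Finset.mem_range] at hr
      have := ih (m - 1 - r) (by omega)
      rw [show ((m - 1 - r : ℕ) : ℤ) = (m : ℤ) - 1 - r by omega] at this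
      rw [pderiv_p, smul_add, ← mul_smul_comm, this]
      congr 2
      · split_ifs with hnr
        · subst hnr
          rw [Nat.succPNat_coe]; congr 1; push_cast; ring
        · rfl
      · congr 1; ring
    rw [Finset.sum_congr rfl e2, Finset.sum_add_distrib, ← N2, C_mul', ← Finset.smul_sum]
    have e3 : ∑ r ∈ Finset.range m, (if n = r.succPNat then h K ((m : ℤ) - n) else 0) =
        h K ((m : ℤ) - n) := by
      by_cases hnm : (n : ℕ) ≤ m
      · rw [Finset.sum_eq_single (n : ℕ).pred]
        · rw [if_pos]
          have := n.pos
          apply PNat.eq; rw [Nat.succPNat_coe]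
          exact (Nat.succ_pred_eq_of_pos n.pos).symm
        · intro b _ hb
          rw [if_neg]
          rintro rfl
          simp at hb
        · intro hh
          have := n.pos
          simp only [Finset.mem_range, not_lt, Nat.pred_eq_sub_one] at hh
          omega
      · rw [h_of_neg (r := (m : ℤ) - n) (by omega)]; simp
    rw [e3, ← add_smul]
    congr 1
    push_cast; ring

/-! ### The operators `(hᵢ[X(t-1)])^⊥` -/

/-- The operator `(hᵢ[X(t-1)])^⊥`. -/
def plethPerp (t : K) (i : ℤ) : SymFun K →ₗ[K] SymFun K := perp (pleth t (h K i))

theorem plethPerp_of_neg [CharZero K] (t : K) {i : ℤ} (hi : i < 0) (f : SymFun K) :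
    plethPerp t i f = 0 := by
  rw [plethPerp, h_of_neg hi, map_zero, perp_zero]

theorem plethPerp_zero [CharZero K] (t : K) (f : SymFun K) : plethPerp t 0 f = f := by
  rw [plethPerp, h_zero, map_one, perp_one]

/-- Newton's identity carried over to operators. It is the recursion on `i` behind the formulas for
`plethPerp` below, where one divides by `i` in characteristic zero. -/
theorem plethPerp_newton [CharZero K] (t : K) (i : ℤ) (N : ℕ) (hN : i ≤ N) (f : SymFun K) :
    (i : K) • plethPerp t i f = ∑ r ∈ Finset.range N,
      ((t ^ (r + 1) - 1) * (r + 1)) • pderiv r.succPNat (plethPerp t (i - 1 - r) f) := by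
  have e : pleth t (C (i : K) * h K i) = C (i : K) * pleth t (h K i) := by
    rw [map_mul, pleth]; simp
  rw [plethPerp, ← perp_C_mul, ← e, newton_h i N hN, map_sum, perp_sum]
  refine Finset.sum_congr rfl fun r _ => ?_
  rw [map_mul, perp_mul, show pleth t (p K r.succPNat) = C (t ^ (r + 1) - 1) * p K r.succPNat by
    rw [pleth, aeval_X, Nat.succPNat_coe], perp_C_mul, perp_p, mul_smul, Nat.succPNat_coe]
  simp [plethPerp]

theorem sum_range_succPNat {M : Type*} [AddCommMonoid M] (n : ℕ+) (N : ℕ) (F : ℕ → M)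
    (hF : N < n → F (n - 1) = 0) :
    ∑ r ∈ Finset.range N, (if r.succPNat = n then F r else 0) = F (n - 1) := by
  have hn := n.pos
  by_cases hnN : (n : ℕ) ≤ N
  · rw [Finset.sum_eq_single ((n : ℕ) - 1)]
    · rw [if_pos]
      apply PNat.eq
      rw [Nat.succPNat_coe]
      omega
    · intro b _ hb
      rw [if_neg]
      rintro rfl
      simp at hb
    · intro hh
      rw [Finset.mem_range] at hh
      omega
  · rw [hF (by omega)]
    refine Finset.sum_eq_zero fun r hr => ?_
    rw [if_neg]
    rintro rfl
    rw [Finset.mem_range] at hr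
    rw [Nat.succPNat_coe] at hnN
    omega

/-- In the recursion, moving `∂/∂p_r` past `p_n` contributes an extra term only for `r = n`, with
coefficient `n (t^n - 1)`; the induction hypothesis supplies `(i - n)(t^n - 1)`. Together they give
`i (t^n - 1)`. -/
theorem plethPerp_p_mul [CharZero K] (t : K) (n : ℕ+) (i : ℤ) (f : SymFun K) :
    plethPerp t i (p K n * f) =
      p K n * plethPerp t i f + (t ^ (n : ℕ) - 1) • plethPerp t (i - n) f := by
  have hn := n.pos
  rcases lt_or_ge i 0 with hi | hi
  · simp [plethPerp_of_neg t hi, plethPerp_of_neg t (show i - n < 0 by omega)]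
  obtain ⟨m, rfl⟩ := Int.eq_ofNat_of_zero_le hi
  clear hi
  induction m using Nat.strong_induction_on with
  | _ m ih =>
    rcases Nat.eq_zero_or_pos m with rfl | hm
    · rw [Nat.cast_zero, plethPerp_zero, plethPerp_zero, plethPerp_of_neg t (by omega), smul_zero,
        add_zero]
    have hm0 : (m : K) ≠ 0 := by exact_mod_cast hm.ne'
    apply smul_right_injective (SymFun K) hm0
    simp only
    have N0 := plethPerp_newton t (m : ℤ) m le_rfl (p K n * f)
    have N1 := plethPerp_newton t (m : ℤ) m le_rfl f
    have N2 := plethPerp_newton t ((m : ℤ) - n) m (by omega) f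
    rw [Int.cast_natCast] at N0 N1
    have e2 : ∀ r ∈ Finset.range m,
        ((t ^ (r + 1) - 1) * (r + 1)) • pderiv r.succPNat
            (plethPerp t ((m : ℤ) - 1 - r) (p K n * f)) =
        (if r.succPNat = n then
          ((t ^ (r + 1) - 1) * (r + 1)) • plethPerp t ((m : ℤ) - 1 - r) f else 0) +
        p K n * (((t ^ (r + 1) - 1) * (r + 1)) • pderiv r.succPNat
            (plethPerp t ((m : ℤ) - 1 - r) f)) +
        (t ^ (n : ℕ) - 1) • (((t ^ (r + 1) - 1) * (r + 1)) • pderiv r.succPNat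
            (plethPerp t ((m : ℤ) - n - 1 - r) f)) := by
      intro r hr
      rw [Finset.mem_range] at hr
      have := ih (m - 1 - r) (by omega)
      rw [show ((m - 1 - r : ℕ) : ℤ) = (m : ℤ) - 1 - r by omega] at this
      rw [this, map_add, pderiv_p, Derivation.map_smul, smul_add, smul_add, mul_smul_comm,
        smul_comm (t ^ (n : ℕ) - 1), show (m : ℤ) - n - 1 - r = m - 1 - r - n by ring, smul_ite,
        smul_zero]
    rw [N0, Finset.sum_congr rfl e2, Finset.sum_add_distrib, Finset.sum_add_distrib,
      ← Finset.mul_sum, ← Finset.smul_sum, ← N1, ← N2,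
      sum_range_succPNat n m
        (fun r => ((t ^ (r + 1) - 1) * (r + 1)) • plethPerp t ((m : ℤ) - 1 - r) f)]
    · obtain ⟨n', hn'⟩ : ∃ n' : ℕ, (n : ℕ) = n' + 1 := ⟨n - 1, by omega⟩
      rw [hn', show n' + 1 - 1 = n' by omega, show (m : ℤ) - ((n' + 1 : ℕ) : ℤ) = m - 1 - n' by
        push_cast; ring, smul_add, mul_smul_comm, add_right_comm, smul_smul, smul_smul, ← add_smul,
        add_comm]
      congr 2
      push_cast
      ring
    · intro hlt
      rw [plethPerp_of_neg t (by omega), smul_zero]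

theorem plethPerp_one [CharZero K] (t : K) {i : ℤ} (hi : 0 < i) :
    plethPerp t i (1 : SymFun K) = 0 := by
  obtain ⟨m, rfl⟩ := Int.eq_ofNat_of_zero_le hi.le
  induction m using Nat.strong_induction_on with
  | _ m ih =>
    have hm0 : (m : K) ≠ 0 := by rw [Nat.cast_ne_zero]; omega
    apply smul_right_injective (SymFun K) hm0
    simp only
    have N1 := plethPerp_newton t (m : ℤ) m le_rfl 1
    rw [Int.cast_natCast] at N1
    rw [N1, smul_zero]
    refine Finset.sum_eq_zero fun r hr => ?_
    rw [Finset.mem_range] at hr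
    by_cases hr1 : m - 1 - r = 0
    · rw [show (m : ℤ) - 1 - r = 0 by omega, plethPerp_zero, Derivation.map_one_eq_zero, smul_zero]
    · have := ih (m - 1 - r) (by omega) (by omega)
      rw [show ((m - 1 - r : ℕ) : ℤ) = (m : ℤ) - 1 - r by omega] at this
      rw [this, map_zero, smul_zero]

theorem plethPerp_eventually_zero [CharZero K] (t : K) (f : SymFun K) :
    ∃ N : ℕ, ∀ i : ℤ, N ≤ i → plethPerp t i f = 0 := by
  induction f using MvPolynomial.induction_on with
  | C c =>
    refine ⟨1, fun i hi => ?_⟩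
    rw [← mul_one (C c), C_mul', map_smul, plethPerp_one t (by omega), smul_zero]
  | add f g hf hg =>
    obtain ⟨N, hN⟩ := hf
    obtain ⟨N', hN'⟩ := hg
    exact ⟨max N N', fun i hi => by rw [map_add, hN i (by omega), hN' i (by omega), add_zero]⟩
  | mul_X f n hf =>
    obtain ⟨N, hN⟩ := hf
    refine ⟨N + n, fun i hi => ?_⟩
    have hn := n.pos
    rw [mul_comm, plethPerp_p_mul, hN i (by omega), hN (i - n) (by omega), mul_zero, smul_zero,
      add_zero]

/-- The value `hᵢ[t - 1]`. -/
def plethOne (t : K) : ℕ → K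
  | 0 => 1
  | i + 1 => t ^ (i + 1) - t ^ i

/-- Newton's identity under the specialization `p_r ↦ t^r - 1`, whose complete functions are the
coefficients of `(1 - z)/(1 - tz)`. The sum telescopes. -/
theorem plethOne_newton (t : K) (i : ℕ) :
    ∑ r ∈ Finset.range i, (t ^ (r + 1) - 1) * plethOne t (i - 1 - r) = i * plethOne t i := by
  cases i with
  | zero => simp
  | succ i =>
    rw [Finset.sum_range_succ, show i + 1 - 1 - i = 0 by omega]
    have e : ∀ r ∈ Finset.range i, (t ^ (r + 1) - 1) * plethOne t (i + 1 - 1 - r) =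
        (t ^ (i + 1) - t ^ i) + (t ^ (i - (r + 1)) - t ^ (i - r)) := by
      intro r hr
      rw [Finset.mem_range] at hr
      obtain ⟨s, rfl⟩ : ∃ s, i = r + 1 + s := ⟨i - r - 1, by omega⟩
      rw [show r + 1 + s + 1 - 1 - r = s + 1 by omega, show r + 1 + s - (r + 1) = s by omega,
        show r + 1 + s - r = s + 1 by omega, plethOne]
      ring
    rw [Finset.sum_congr rfl e, Finset.sum_add_distrib,
      Finset.sum_range_sub (fun r => t ^ (i - r)) i]
    simp [plethOne]
    ring

/-- Each `p_r^⊥` lowers the index of `h` by `r`, so on the `h_b` a homogeneous `f^⊥` acts as an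
index shift times the value of `f` at `p_r = 1`; for `f = h_i[X(t-1)]` this value is `h_i[t-1]`. -/
theorem plethPerp_h [CharZero K] (t : K) (i : ℕ) (b : ℤ) :
    plethPerp t i (h K b) = plethOne t i • h K (b - i) := by
  induction i using Nat.strong_induction_on with
  | _ m ih =>
    rcases Nat.eq_zero_or_pos m with rfl | hm
    · rw [Nat.cast_zero, plethPerp_zero, plethOne, one_smul, sub_zero]
    have hm0 : (m : K) ≠ 0 := by exact_mod_cast hm.ne'
    apply smul_right_injective (SymFun K) hm0
    simp only
    have N1 := plethPerp_newton t (m : ℤ) m le_rfl (h K b)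
    rw [Int.cast_natCast] at N1
    rw [N1, smul_smul, ← plethOne_newton, Finset.sum_smul]
    refine Finset.sum_congr rfl fun r hr => ?_
    rw [Finset.mem_range] at hr
    have := ih (m - 1 - r) (by omega)
    rw [show ((m - 1 - r : ℕ) : ℤ) = (m : ℤ) - 1 - r by omega] at this
    have h1 := pderiv_h (K := K) r.succPNat (b - (m - 1 - r))
    rw [Nat.succPNat_coe, show b - ((m : ℤ) - 1 - r) - (r.succ : ℕ) = b - m by push_cast; ring] at h1
    rw [← h1, this, Derivation.map_smul, smul_smul, smul_smul]
    congr 1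
    push_cast
    ring

/-! ### Relations between vertex operators -/

theorem vertex_apply [CharZero K] (t : K) (m : ℤ) (f : SymFun K) {N : ℕ}
    (hN : ∀ i : ℤ, N ≤ i → plethPerp t i f = 0) :
    vertex t m f = ∑ i ∈ Finset.range N, h K (i + m) * plethPerp t i f := by
  change (∑ᶠ i : ℕ, h K (i + m) * plethPerp t i f) = _
  refine finsum_eq_sum_of_support_subset _ fun i hi => ?_
  rw [Function.mem_support] at hi
  rw [Finset.coe_range, Set.mem_Iio]
  by_contra hc
  exact hi (by rw [hN i (by omega), mul_zero])

theorem vertex_one [CharZero K] (t : K) (m : ℤ) : vertex t m (1 : SymFun K) = h K m := by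
  rw [vertex_apply t m 1 (N := 1) fun i hi => plethPerp_one t (by omega)]
  simp [plethPerp_zero]

/-- Together with `vertex_one` this determines `B_m` on all of `Λ`, so relations between vertex
operators can be proved by induction on polynomials in the `p_n`. -/
theorem vertex_p_mul [CharZero K] (t : K) (m : ℤ) (n : ℕ+) (f : SymFun K) :
    vertex t m (p K n * f) = p K n * vertex t m f + (t ^ (n : ℕ) - 1) • vertex t (m + n) f := by
  obtain ⟨N, hN⟩ := plethPerp_eventually_zero t f
  have hn := n.pos
  have h0 : ∀ i : ℤ, ((n + N : ℕ) : ℤ) ≤ i → plethPerp t i (p K n * f) = 0 := fun i hi => by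
    rw [plethPerp_p_mul, hN i (by omega), hN (i - n) (by omega), mul_zero, smul_zero, add_zero]
  rw [vertex_apply t m _ h0, vertex_apply t m f (N := n + N) (fun i hi => hN i (by omega)),
    vertex_apply t (m + n) f hN]
  simp only [plethPerp_p_mul, mul_add, Finset.sum_add_distrib, Finset.mul_sum, Finset.smul_sum,
    mul_left_comm (h K _) (p K n)]
  rw [Finset.sum_range_add (fun x : ℕ => h K (x + m) * ((t ^ (n : ℕ) - 1) • plethPerp t (x - n) f)),
    Finset.sum_eq_zero (s := Finset.range n), zero_add]
  · refine congrArg _ (Finset.sum_congr rfl fun i _ => ?_)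
    push_cast
    rw [mul_smul_comm, add_sub_cancel_left]
    congr 3
    ring
  · intro i hi
    rw [Finset.mem_range] at hi
    rw [plethPerp_of_neg t (by omega), smul_zero, mul_zero]

/-- The operator `B_{(a,b)} = B_a B_b - t B_{a+1} B_{b-1}`. -/
def vertexPair (t : K) (a b : ℤ) : Module.End K (SymFun K) :=
  vertex t a * vertex t b - t • (vertex t (a + 1) * vertex t (b - 1))

/-- In `B_a h_b - t B_{a+1} h_{b-1}` the coefficient of `h_{a+i} h_{b-i}` is `1` for `i = 0`, `(t -
1) - t = -1` for `i = 1`, and `0` for `i ≥ 2`, since `h_i[t-1] = t h_{i-1}[t-1]` there. -/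
theorem vertexPair_one [CharZero K] (t : K) (a b : ℤ) :
    vertexPair t a b (1 : SymFun K) = h K a * h K b - h K (a + 1) * h K (b - 1) := by
  have h0 : ∀ c : ℤ, c ≤ b → ∀ i : ℤ, ((b.toNat + 1 : ℕ) : ℤ) ≤ i → plethPerp t i (h K c) = 0 := by
    intro c hc i hi
    obtain ⟨n, rfl⟩ := Int.eq_ofNat_of_zero_le (show 0 ≤ i by omega)
    rw [plethPerp_h, h_of_neg (by omega), smul_zero]
  simp only [vertexPair, LinearMap.sub_apply, LinearMap.smul_apply, Module.End.mul_apply,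
    vertex_one]
  rw [vertex_apply t a _ (N := b.toNat + 1 + 1) (fun i hi => h0 b le_rfl i (by omega)),
    vertex_apply t (a + 1) _ (h0 (b - 1) (by omega)), Finset.sum_range_succ', Finset.smul_sum,
    add_sub_right_comm, ← Finset.sum_sub_distrib, Finset.sum_range_succ', Finset.sum_eq_zero]
  · simp only [plethPerp_h, plethOne]
    rw [Nat.cast_zero, show ((0 + 1 : ℕ) : ℤ) = 1 from rfl]
    simp only [zero_add, sub_zero, pow_one, pow_zero, one_smul, sub_smul,
      add_comm (1 : ℤ)]
    rw [mul_sub, mul_smul_comm]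
    abel
  · intro i _
    simp only [plethPerp_h, plethOne, mul_smul_comm, smul_smul]
    rw [show ((i + 1 : ℕ) : ℤ) + (a + 1) = ((i + 1 + 1 : ℕ) : ℤ) + a by push_cast; ring,
      show b - 1 - ((i + 1 : ℕ) : ℤ) = b - ((i + 1 + 1 : ℕ) : ℤ) by push_cast; ring, ← sub_smul,
      show t ^ (i + 1 + 1) - t ^ (i + 1) - t * (t ^ (i + 1) - t ^ i) = 0 by ring, zero_smul]

theorem vertexPair_p_mul [CharZero K] (t : K) (a b : ℤ) (n : ℕ+) (f : SymFun K) :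
    vertexPair t a b (p K n * f) = p K n * vertexPair t a b f +
      (t ^ (n : ℕ) - 1) • (vertexPair t (a + n) b f + vertexPair t a (b + n) f) := by
  simp only [vertexPair, LinearMap.sub_apply, LinearMap.smul_apply, Module.End.mul_apply,
    vertex_p_mul, map_add, map_smul, add_right_comm _ (n : ℤ) (1 : ℤ),
    show b + (n : ℤ) - 1 = b - 1 + n by ring, mul_sub, smul_add, smul_sub, mul_smul_comm,
    smul_comm t]
  abel

/-- The straightening relation for two vertex operators. -/
theorem vertexPair_swap [CharZero K] (t : K) (a b : ℤ) :
    vertexPair t a b = -vertexPair t (b - 1) (a + 1) := by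
  rw [← add_eq_zero_iff_eq_neg]
  refine LinearMap.ext fun f => ?_
  -- Moving past `p_n` raises one of the indices by `n`, so the induction needs all pairs `(a, b)`
  -- at once.
  induction f using MvPolynomial.induction_on generalizing a b with
  | C c =>
    rw [← mul_one (C c), C_mul', map_smul, LinearMap.add_apply, vertexPair_one, vertexPair_one,
      sub_add_cancel, add_sub_cancel_right, mul_comm (h K (b - 1)), mul_comm (h K b),
      sub_add_sub_cancel, sub_self, smul_zero]
    rfl
  | add f g hf hg => rw [map_add, map_add, hf, hg]
  | mul_X f n hf =>
    have h1 := hf a b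
    have h2 := hf (a + n) b
    have h3 := hf a (b + n)
    simp only [LinearMap.add_apply, LinearMap.zero_apply] at h1 h2 h3 ⊢
    rw [mul_comm, vertexPair_p_mul, vertexPair_p_mul, eq_neg_of_add_eq_zero_left h1,
      eq_neg_of_add_eq_zero_left h2, eq_neg_of_add_eq_zero_left h3, sub_add_eq_add_sub,
      add_right_comm a]
    simp only [smul_add, smul_neg, mul_neg]
    abel

/-! ### Concatenation of integer vectors -/

theorem prod_pairs_add {M : Type*} [CommMonoid M] {m n : ℕ} (g : Fin (m + n) → Fin (m + n) → M) :
    ∏ q : Fin (m + n) × Fin (m + n) with q.1 < q.2, g q.1 q.2 =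
      (∏ q : Fin m × Fin m with q.1 < q.2, g (Fin.castAdd n q.1) (Fin.castAdd n q.2)) *
        (∏ i, ∏ j, g (Fin.castAdd n i) (Fin.natAdd m j)) *
        ∏ q : Fin n × Fin n with q.1 < q.2, g (Fin.natAdd m q.1) (Fin.natAdd m q.2) := by
  have h1 : ∀ (i : Fin m) (j : Fin n), Fin.castAdd n i < Fin.natAdd m j := fun i j => by
    rw [Fin.lt_def, Fin.val_castAdd, Fin.val_natAdd]; omega
  have h2 : ∀ (i : Fin m) (j : Fin n), ¬ Fin.natAdd m j < Fin.castAdd n i := fun i j =>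
    (h1 i j).not_gt
  have h3 : ∀ i j : Fin m, Fin.castAdd n i < Fin.castAdd n j ↔ i < j := fun i j => Iff.rfl
  have h4 : ∀ i j : Fin n, Fin.natAdd m i < Fin.natAdd m j ↔ i < j := fun i j => by
    rw [Fin.lt_def, Fin.val_natAdd, Fin.val_natAdd, Fin.lt_def]; omega
  simp only [Finset.prod_filter, Fintype.prod_prod_type, Fin.prod_univ_add, h1, h2, h3, h4,
    if_true, if_false, Finset.prod_mul_distrib, Finset.prod_const_one, mul_one, mul_assoc]

/-- The linear extension of `v ↦ B_{v₁} ⋯ B_{v_L}` to the group algebra of `ℤ^L`. -/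
def wordLin (t : K) (L : ℕ) : AddMonoidAlgebra K (Fin L → ℤ) →ₗ[K] Module.End K (SymFun K) :=
  (Finsupp.linearCombination K (word t)).comp
    (AddMonoidAlgebra.coeffLinearEquiv K).toLinearMap

theorem wordLin_single (t : K) {L : ℕ} (v : Fin L → ℤ) (c : K) :
    wordLin t L (AddMonoidAlgebra.single v c) = c • word t v := by
  rw [wordLin, LinearMap.comp_apply]
  exact Finsupp.linearCombination_single K c v

theorem vertexVec_eq (t : K) {L : ℕ} (v : Fin L → ℤ) :
    vertexVec t v = wordLin t L (raising t L * AddMonoidAlgebra.single v 1) := rfl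

theorem word_append (t : K) {m n : ℕ} (u : Fin m → ℤ) (v : Fin n → ℤ) :
    word t (Fin.append u v) = word t u * word t v := by
  have e : (fun i => vertex t (Fin.append u v i)) =
      Fin.append (fun i => vertex t (u i)) (fun i => vertex t (v i)) := by
    refine funext fun i => ?_
    induction i using Fin.addCases <;> simp
  rw [word, e, List.ofFn_fin_append, List.prod_append]
  rfl

theorem append_add {m n : ℕ} (u u' : Fin m → ℤ) (v v' : Fin n → ℤ) :
    Fin.append u v + Fin.append u' v' = Fin.append (u + u') (v + v') := by
  refine funext fun i => ?_
  induction i using Fin.addCases <;> simp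

/-- The embedding of `ℤ^m` into `ℤ^{m+n}` as the first coordinates. -/
def appendLeftHom (m n : ℕ) : (Fin m → ℤ) →+ (Fin (m + n) → ℤ) where
  toFun u := Fin.append u 0
  map_zero' := by
    refine funext fun i => ?_
    induction i using Fin.addCases <;> simp
  map_add' u v := by rw [append_add, add_zero]

/-- The embedding of `ℤ^n` into `ℤ^{m+n}` as the last coordinates. -/
def appendRightHom (m n : ℕ) : (Fin n → ℤ) →+ (Fin (m + n) → ℤ) where
  toFun u := Fin.append 0 u
  map_zero' := by
    refine funext fun i => ?_
    induction i using Fin.addCases <;> simp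
  map_add' u v := by rw [append_add, add_zero]

theorem wordLin_append (t : K) {m n : ℕ} (a : AddMonoidAlgebra K (Fin m → ℤ))
    (b : AddMonoidAlgebra K (Fin n → ℤ)) (u : Fin m → ℤ) (v : Fin n → ℤ) :
    wordLin t (m + n) (AddMonoidAlgebra.mapDomainRingHom K (appendLeftHom m n) a *
      AddMonoidAlgebra.mapDomainRingHom K (appendRightHom m n) b *
        AddMonoidAlgebra.single (Fin.append u v) 1) =
      wordLin t m (a * AddMonoidAlgebra.single u 1) *
        wordLin t n (b * AddMonoidAlgebra.single v 1) := by
  induction a using AddMonoidAlgebra.induction_linear with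
  | zero => simp
  | add a a' ha ha' => simp only [map_add, add_mul, ha, ha']
  | single w c =>
    induction b using AddMonoidAlgebra.induction_linear with
    | zero => simp
    | add b b' hb hb' => simp only [map_add, add_mul, mul_add, hb, hb']
    | single w' c' =>
      have e1 : AddMonoidAlgebra.mapDomainRingHom K (appendLeftHom m n)
          (AddMonoidAlgebra.single w c) = AddMonoidAlgebra.single (Fin.append w 0) c :=
        AddMonoidAlgebra.mapDomain_single
      have e2 : AddMonoidAlgebra.mapDomainRingHom K (appendRightHom m n)
          (AddMonoidAlgebra.single w' c') = AddMonoidAlgebra.single (Fin.append 0 w') c' :=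
        AddMonoidAlgebra.mapDomain_single
      rw [e1, e2]
      simp only [AddMonoidAlgebra.single_mul_single, wordLin_single, append_add, word_append,
        mul_one, add_zero, zero_add, smul_mul_smul_comm]

/-- The row sums of a `0`-`1`-matrix. -/
def rowSum {m n : ℕ} (s : Fin m → Fin n → Fin 2) (i : Fin m) : ℤ := ∑ j, ((s i j : ℕ) : ℤ)

/-- The column sums of a `0`-`1`-matrix. -/
def colSum {m n : ℕ} (s : Fin m → Fin n → Fin 2) (j : Fin n) : ℤ := ∑ i, ((s i j : ℕ) : ℤ)

/-- The weight `(-t)^N` of a `0`-`1`-matrix with `N` entries equal to `1`. -/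
def weight (t : K) {m n : ℕ} (s : Fin m → Fin n → Fin 2) : K := ∏ i, ∏ j, (-t) ^ (s i j : ℕ)

/-- The factor `1 - t e_{ij}` of `raising`. -/
def raisingFactor (t : K) {L : ℕ} (i j : Fin L) : AddMonoidAlgebra K (Fin L → ℤ) :=
  1 - AddMonoidAlgebra.single (Pi.single i 1 - Pi.single j 1) t

theorem raising_eq (t : K) (L : ℕ) :
    raising t L = ∏ q : Fin L × Fin L with q.1 < q.2, raisingFactor t q.1 q.2 := rfl

theorem prod_cross (t : K) (m n : ℕ) :
    (∏ i : Fin m, ∏ j : Fin n, raisingFactor t (Fin.castAdd n i) (Fin.natAdd m j)) =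
    ∑ s : Fin m → Fin n → Fin 2,
      AddMonoidAlgebra.single (Fin.append (rowSum s) (-colSum s)) (weight t s) := by
  have e : ∀ x : Fin (m + n) → ℤ, (1 - AddMonoidAlgebra.single x t) =
      ∑ c : Fin 2, AddMonoidAlgebra.single (((c : ℕ) : ℤ) • x) ((-t) ^ (c : ℕ)) := by
    intro x
    rw [Fin.sum_univ_two]
    simp [AddMonoidAlgebra.one_def, sub_eq_add_neg]
  simp only [raisingFactor, e, Fintype.prod_sum, AddMonoidAlgebra.prod_single]
  refine Finset.sum_congr rfl fun s _ => ?_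
  congr 1
  refine funext fun a => ?_
  simp only [Finset.sum_apply, Pi.smul_apply, Pi.sub_apply, smul_eq_mul]
  induction a using Fin.addCases with
  | left a =>
    rw [Fin.append_left, Finset.sum_eq_single a]
    · refine Finset.sum_congr rfl fun j _ => ?_
      rw [Pi.single_eq_same, Pi.single_eq_of_ne, sub_zero, mul_one]
      rw [ne_eq, Fin.ext_iff, Fin.val_castAdd, Fin.val_natAdd]
      omega
    · intro i _ hi
      refine Finset.sum_eq_zero fun j _ => ?_
      have : (a : ℕ) ≠ i := fun hh => hi (Fin.ext hh.symm)
      rw [Pi.single_eq_of_ne, Pi.single_eq_of_ne, sub_self, mul_zero]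
      · rw [ne_eq, Fin.ext_iff, Fin.val_castAdd, Fin.val_natAdd]
        omega
      · rw [ne_eq, Fin.ext_iff, Fin.val_castAdd, Fin.val_castAdd]
        exact this
    · simp
  | right a =>
    rw [Fin.append_right]
    simp only [Pi.neg_apply, colSum, ← Finset.sum_neg_distrib]
    refine Finset.sum_congr rfl fun i _ => ?_
    rw [Finset.sum_eq_single a]
    · have : m + (a : ℕ) ≠ i := by omega
      simp [Fin.ext_iff, this]
    · intro j _ hj
      have h1 : (a : ℕ) ≠ j := fun hh => hj (Fin.ext hh.symm)
      have h2 : m + (a : ℕ) ≠ i := by omega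
      simp [Fin.ext_iff, h1, h2]
    · simp

/-- The factors `1 - t e_{ij}` with both indices in one group build the two smaller operators.
Choosing a term from each cross factor gives a 0-1 matrix, whose row sums raise `u` and whose column
sums lower `v`. -/
theorem vertexVec_append (t : K) {m n : ℕ} (u : Fin m → ℤ) (v : Fin n → ℤ) :
    vertexVec t (Fin.append u v) = ∑ s : Fin m → Fin n → Fin 2,
      weight t s • (vertexVec t (u + rowSum s) * vertexVec t (v - colSum s)) := by
  have eL : ∀ i j : Fin m, raisingFactor t (Fin.castAdd n i) (Fin.castAdd n j) =
      AddMonoidAlgebra.mapDomainRingHom K (appendLeftHom m n) (raisingFactor t i j) := by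
    intro i j
    rw [raisingFactor, raisingFactor, map_sub, map_one]
    congr 1
    refine Eq.trans ?_ AddMonoidAlgebra.mapDomain_single.symm
    congr 1
    refine funext fun a => ?_
    induction a using Fin.addCases with
    | left a => simp [appendLeftHom, Pi.single_apply]
    | right a =>
      have h1 : ∀ i : Fin m, m + (a : ℕ) ≠ i := fun i => by omega
      simp [appendLeftHom, Fin.ext_iff, h1]
  have eR : ∀ i j : Fin n, raisingFactor t (Fin.natAdd m i) (Fin.natAdd m j) =
      AddMonoidAlgebra.mapDomainRingHom K (appendRightHom m n) (raisingFactor t i j) := by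
    intro i j
    rw [raisingFactor, raisingFactor, map_sub, map_one]
    congr 1
    refine Eq.trans ?_ AddMonoidAlgebra.mapDomain_single.symm
    congr 1
    refine funext fun a => ?_
    induction a using Fin.addCases with
    | left a =>
      have h1 : ∀ i : Fin n, (a : ℕ) ≠ m + i := fun i => by omega
      simp [appendRightHom, Fin.ext_iff, h1]
    | right a => simp [appendRightHom, Pi.single_apply]
  have e : raising t (m + n) = AddMonoidAlgebra.mapDomainRingHom K (appendLeftHom m n) (raising t m) *
      (∑ s : Fin m → Fin n → Fin 2,
        AddMonoidAlgebra.single (Fin.append (rowSum s) (-colSum s)) (weight t s)) *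
      AddMonoidAlgebra.mapDomainRingHom K (appendRightHom m n) (raising t n) := by
    rw [raising_eq, raising_eq, raising_eq, prod_pairs_add, prod_cross]
    simp only [eL, eR, map_prod]
  rw [vertexVec_eq, e, mul_right_comm _ (∑ s, _), mul_assoc, Finset.sum_mul, Finset.mul_sum, map_sum]
  refine Finset.sum_congr rfl fun s _ => ?_
  rw [vertexVec_eq, vertexVec_eq, ← wordLin_append, ← map_smul, AddMonoidAlgebra.single_mul_single,
    mul_one, append_add, ← mul_smul_comm, AddMonoidAlgebra.smul_single', mul_one, add_comm u,
    sub_eq_neg_add]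

theorem vertexVec_one_entry (t : K) (v : Fin 1 → ℤ) : vertexVec t v = vertex t (v 0) := by
  rw [vertexVec_eq, raising, Finset.prod_eq_one]
  · rw [one_mul, wordLin_single, one_smul]; simp [word]
  · intro q hq
    simp [Subsingleton.elim q.1 q.2] at hq

theorem vertexVec_two_entries (t : K) (v : Fin 2 → ℤ) :
    vertexVec t v = vertexPair t (v 0) (v 1) := by
  have : (Finset.univ.filter fun q : Fin 2 × Fin 2 => q.1 < q.2) = {(0, 1)} := by decide
  rw [vertexVec_eq, raising, this, Finset.prod_singleton, sub_mul, one_mul,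
    AddMonoidAlgebra.single_mul_single, map_sub, wordLin_single, wordLin_single]
  simp [word, vertexPair, add_comm, sub_eq_add_neg]

/-! ### Straightening -/

/-- The operators `B_v` in terms of the shifted vector `vᵢ - i`, in which they are alternating. -/
def vertexAlt (t : K) {L : ℕ} (x : Fin L → ℤ) : Module.End K (SymFun K) :=
  vertexVec t fun i => x i + i

theorem rowSum_comp {m n : ℕ} (s : Fin m → Fin n → Fin 2) (σ : Fin m → Fin m) :
    rowSum (s ∘ σ) = rowSum s ∘ σ := rfl

theorem vertexAlt_append (t : K) {m n : ℕ} (x : Fin m → ℤ) (y : Fin n → ℤ) :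
    vertexAlt t (Fin.append x y) = ∑ s : Fin m → Fin n → Fin 2,
      weight t s • (vertexAlt t (x + rowSum s) * vertexAlt t (fun j => y j + m - colSum s j)) := by
  have e : (fun i => Fin.append x y i + ((i : ℕ) : ℤ)) =
      Fin.append (fun i => x i + ((i : ℕ) : ℤ)) (fun j => y j + ((m + j : ℕ) : ℤ)) := by
    refine funext fun i => ?_
    induction i using Fin.addCases <;> simp
  rw [vertexAlt, e, vertexVec_append]
  refine Finset.sum_congr rfl fun s _ => ?_
  congr 2
  · refine congrArg _ (funext fun i => ?_)
    simp only [Pi.add_apply]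
    ring
  · refine congrArg _ (funext fun i => ?_)
    simp only [Pi.sub_apply]
    push_cast
    ring

/-- `σ` acts on the operators `B_v` by its sign. -/
def IsAlt (t : K) {L : ℕ} (σ : Equiv.Perm (Fin L)) : Prop :=
  ∀ x : Fin L → ℤ, vertexAlt t (x ∘ σ) = (Equiv.Perm.sign σ : ℤ) • vertexAlt t x

theorem append_comp_left {m n : ℕ} {α : Type*} (x : Fin m → α) (y : Fin n → α)
    (σ : Equiv.Perm (Fin m)) :
    Fin.append x y ∘ finSumFinEquiv.permCongr (Equiv.Perm.sumCongr σ 1) =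
      Fin.append (x ∘ σ) y := by
  refine funext fun i => ?_
  induction i using Fin.addCases <;> simp [Equiv.permCongr_apply]

theorem append_comp_right {m n : ℕ} {α : Type*} (x : Fin m → α) (y : Fin n → α)
    (σ : Equiv.Perm (Fin n)) :
    Fin.append x y ∘ finSumFinEquiv.permCongr (Equiv.Perm.sumCongr 1 σ) =
      Fin.append x (y ∘ σ) := by
  refine funext fun i => ?_
  induction i using Fin.addCases <;> simp [Equiv.permCongr_apply]

theorem exists_eq_append {m n : ℕ} {α : Type*} (x : Fin (m + n) → α) :
    ∃ (u : Fin m → α) (v : Fin n → α), x = Fin.append u v :=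
  ⟨fun i => x (Fin.castAdd n i), fun i => x (Fin.natAdd m i), by
    refine funext fun i => ?_
    induction i using Fin.addCases <;> simp⟩

/-- Permuting the rows of the 0-1 matrix along with `u` keeps its weight and column sums and
permutes its row sums. -/
theorem IsAlt.left {t : K} {m : ℕ} (n : ℕ) {σ : Equiv.Perm (Fin m)} (hσ : IsAlt t σ) :
    IsAlt t (finSumFinEquiv.permCongr (Equiv.Perm.sumCongr σ (1 : Equiv.Perm (Fin n)))) := by
  intro x
  obtain ⟨u, v, rfl⟩ := exists_eq_append x
  rw [append_comp_left, vertexAlt_append, vertexAlt_append, Finset.smul_sum]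
  symm
  refine Fintype.sum_equiv (Equiv.arrowCongr σ.symm (Equiv.refl _)) _ _ fun s => ?_
  have h1 : (Equiv.arrowCongr σ.symm (Equiv.refl (Fin n → Fin 2))) s = s ∘ σ := rfl
  have h2 : weight t (s ∘ σ) = weight t s :=
    Equiv.prod_comp σ fun i => ∏ j, (-t) ^ ((s i j : Fin 2) : ℕ)
  have h3 : colSum (s ∘ σ) = colSum s := funext fun j =>
    Equiv.sum_comp σ fun i => (((s i j : Fin 2) : ℕ) : ℤ)
  rw [h1, h2, h3, rowSum_comp, Equiv.Perm.sign_permCongr, Equiv.Perm.sign_sumCongr,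
    Equiv.Perm.sign_one, mul_one, show u ∘ σ + rowSum s ∘ σ = (u + rowSum s) ∘ σ from rfl, hσ,
    smul_mul_assoc, smul_comm]

theorem IsAlt.right {t : K} (m : ℕ) {n : ℕ} {σ : Equiv.Perm (Fin n)} (hσ : IsAlt t σ) :
    IsAlt t (finSumFinEquiv.permCongr (Equiv.Perm.sumCongr (1 : Equiv.Perm (Fin m)) σ)) := by
  intro x
  obtain ⟨u, v, rfl⟩ := exists_eq_append x
  rw [append_comp_right, vertexAlt_append, vertexAlt_append, Finset.smul_sum]
  symm
  refine Fintype.sum_equiv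
    (Equiv.arrowCongr (Equiv.refl _) (Equiv.arrowCongr σ.symm (Equiv.refl _))) _ _ fun s => ?_
  have h1 : (Equiv.arrowCongr (Equiv.refl (Fin m)) (Equiv.arrowCongr σ.symm (Equiv.refl (Fin 2)))) s
      = fun i => s i ∘ σ := rfl
  have h2 : weight t (fun i => s i ∘ σ) = weight t s :=
    Finset.prod_congr rfl fun i _ => Equiv.prod_comp σ fun j => (-t) ^ ((s i j : Fin 2) : ℕ)
  have h3 : rowSum (fun i => s i ∘ σ) = rowSum s := funext fun i =>
    Equiv.sum_comp σ fun j => (((s i j : Fin 2) : ℕ) : ℤ)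
  rw [h1, h2, h3, Equiv.Perm.sign_permCongr, Equiv.Perm.sign_sumCongr,
    Equiv.Perm.sign_one, one_mul, show (fun j => (v ∘ σ) j + (m : ℤ) - colSum (fun i => s i ∘ σ) j)
      = (fun j => v j + (m : ℤ) - colSum s j) ∘ σ from rfl, hσ, mul_smul_comm, smul_comm]

theorem isAlt_swap_two [CharZero K] (t : K) : IsAlt t (Equiv.swap (0 : Fin 2) 1) := by
  intro x
  rw [vertexAlt, vertexAlt, vertexVec_two_entries, vertexVec_two_entries, vertexPair_swap,
    Equiv.Perm.sign_swap (by decide)]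
  simp

theorem isAlt [CharZero K] (t : K) {L : ℕ} (σ : Equiv.Perm (Fin L)) : IsAlt t σ := by
  cases L with
  | zero =>
    rw [Subsingleton.elim σ 1]
    intro x
    simp
  | succ L =>
    -- Adjacent transpositions generate the symmetric group, and each is the two-entry swap with `a`
    -- entries before it and `r` after it.
    have hσ : σ ∈ Submonoid.closure (Set.range fun i : Fin L => Equiv.swap i.castSucc i.succ) := by
      rw [Equiv.Perm.mclosure_swap_castSucc_succ]; trivial
    induction hσ using Submonoid.closure_induction with
    | mem σ hσ =>
      obtain ⟨i, rfl⟩ := hσ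
      obtain ⟨a, ha⟩ := i
      obtain ⟨r, rfl⟩ : ∃ r, L = a + 1 + r := ⟨L - (a + 1), by omega⟩
      have hL : a + 1 + r + 1 = a + 2 + r := by omega
      have key := ((isAlt_swap_two t).right a).left r
      have h2 : (finSumFinEquiv.permCongr (Equiv.Perm.sumCongr (finSumFinEquiv.permCongr
          (Equiv.Perm.sumCongr (1 : Equiv.Perm (Fin a)) (Equiv.swap (0 : Fin 2) 1)))
          (1 : Equiv.Perm (Fin r)))) =
          Equiv.swap (⟨a, by omega⟩ : Fin (a + 2 + r)) ⟨a + 1, by omega⟩ := by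
        have h3 : finSumFinEquiv.permCongr
            (Equiv.Perm.sumCongr (1 : Equiv.Perm (Fin a)) (Equiv.swap (0 : Fin 2) 1)) =
            Equiv.swap (Fin.natAdd a 0) (Fin.natAdd a 1) := by
          rw [Equiv.Perm.sumCongr_one_swap]
          exact Equiv.symm_trans_swap_trans _ _ _
        rw [h3, Equiv.Perm.sumCongr_swap_one]
        exact Equiv.symm_trans_swap_trans _ _ _
      rw [h2] at key
      clear h2
      change IsAlt t (Equiv.swap (⟨a, by omega⟩ : Fin (a + 1 + r + 1)) ⟨a + 1, by omega⟩)
      generalize_proofs p1 p2 p3 p4 at key ⊢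
      clear ha
      revert p1 p2 p3 p4
      rw [hL]
      intros
      assumption
    | one =>
      intro x
      simp
    | mul σ τ _ _ hσ hτ =>
      intro x
      rw [Equiv.Perm.coe_mul, ← Function.comp_assoc, hτ, hσ, smul_smul, Equiv.Perm.sign_mul,
        Units.val_mul, mul_comm]

theorem vertexAlt_comp [CharZero K] (t : K) {L : ℕ} (σ : Equiv.Perm (Fin L)) (x : Fin L → ℤ) :
    vertexAlt t (x ∘ σ) = (Equiv.Perm.sign σ : ℤ) • vertexAlt t x := isAlt t σ x

theorem vertexAlt_eq_zero [CharZero K] (t : K) {L : ℕ} (x : Fin L → ℤ) {i j : Fin L}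
    (hij : i ≠ j) (hx : x i = x j) : vertexAlt t x = 0 := by
  have h1 := vertexAlt_comp t (Equiv.swap i j) x
  have h2 : x ∘ Equiv.swap i j = x := by
    refine funext fun a => ?_
    rw [Function.comp_apply, Equiv.swap_apply_def]
    split_ifs with h1 h2
    · rw [h1, hx]
    · rw [h2, hx]
    · rfl
  rw [h2, Equiv.Perm.sign_swap hij, Units.val_neg, Units.val_one, neg_smul, one_smul] at h1
  have h3 : (2 : K) • vertexAlt t x = 0 := by
    rw [two_smul]
    nth_rewrite 1 [h1]
    rw [neg_add_cancel]
  exact (smul_eq_zero.mp h3).resolve_left two_ne_zero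

/-! ### Exchange of a rectangle with another factor -/

/-- If `r_b = d` is the first nonzero excess, its shifted entry `ℓ + d - (n + b)` is also that of
the position `d` places earlier. That position exists because `d ≤ n`, and its entry is `ℓ` by
minimality of `b`. -/
theorem vertexVec_rectangle_append_eq_zero [CharZero K] (t : K) {n q : ℕ} (ℓ : ℤ) (r : Fin q → ℤ)
    (h0 : ∀ b, 0 ≤ r b) (hn : ∀ b, r b ≤ n) (hr : r ≠ 0) :
    vertexVec t (Fin.append (fun _ : Fin n => ℓ) (fun b => ℓ + r b)) = 0 := by
  have hex : ∃ b : ℕ, ∃ hb : b < q, r ⟨b, hb⟩ ≠ 0 := by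
    obtain ⟨b, hb⟩ := Function.ne_iff.mp hr
    exact ⟨b, b.2, hb⟩
  classical
  obtain ⟨hb, hrb⟩ := Nat.find_spec hex
  have hmin := fun c => Nat.find_min hex (m := c)
  set b := Nat.find hex with hbdef
  have h1 := h0 ⟨b, hb⟩
  have h2 := hn ⟨b, hb⟩
  obtain ⟨d, hd⟩ := Int.eq_ofNat_of_zero_le h1
  have hd0 : d ≠ 0 := by rintro rfl; exact hrb (by rw [hd]; rfl)
  have e : vertexVec t (Fin.append (fun _ : Fin n => ℓ) (fun b => ℓ + r b)) =
      vertexAlt t fun i => Fin.append (fun _ : Fin n => ℓ) (fun b => ℓ + r b) i - i := by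
    rw [vertexAlt]; simp
  have hc : n + b - d < n + q := by omega
  rw [e]
  refine vertexAlt_eq_zero t _ (i := Fin.natAdd n ⟨b, hb⟩) (j := ⟨n + b - d, hc⟩) ?_ ?_
  · rw [ne_eq, Fin.ext_iff, Fin.val_natAdd]
    simp only
    omega
  · have h3 : Fin.append (fun _ : Fin n => ℓ) (fun b => ℓ + r b) ⟨n + b - d, hc⟩ = ℓ := by
      by_cases hlt : n + b - d < n
      · exact Fin.append_left (fun _ : Fin n => ℓ) (fun b => ℓ + r b) ⟨n + b - d, hlt⟩
      · have h4 : r ⟨b - d, by omega⟩ = 0 := by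
          by_contra hne
          exact hmin (b - d) (by omega) ⟨by omega, hne⟩
        have h5 : (⟨n + b - d, hc⟩ : Fin (n + q)) = Fin.natAdd n ⟨b - d, by omega⟩ := by
          ext; simp; omega
        rw [h5, Fin.append_right, h4, add_zero]
    rw [h3, Fin.append_right, Fin.val_natAdd, hd]
    push_cast [show d ≤ n + b by omega]
    ring

theorem rowSum_eq_zero {m n : ℕ} {s : Fin m → Fin n → Fin 2} (hs : rowSum s = 0) : s = 0 := by
  refine funext fun i => funext fun j => ?_
  have h1 := congrFun hs i
  rw [rowSum, Pi.zero_apply, Finset.sum_eq_zero_iff_of_nonneg (fun _ _ => by positivity)] at h1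
  have := h1 j (Finset.mem_univ j)
  ext
  simpa using this

theorem rowSum_zero (m n : ℕ) : rowSum (0 : Fin m → Fin n → Fin 2) = 0 := by
  refine funext fun i => ?_
  simp [rowSum]

theorem colSum_zero (m n : ℕ) : colSum (0 : Fin m → Fin n → Fin 2) = 0 := by
  refine funext fun i => ?_
  simp [colSum]

theorem weight_zero (t : K) (m n : ℕ) : weight t (0 : Fin m → Fin n → Fin 2) = 1 := by
  simp [weight]

theorem rowSum_nonneg {m n : ℕ} (s : Fin m → Fin n → Fin 2) (i : Fin m) : 0 ≤ rowSum s i :=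
  Finset.sum_nonneg fun _ _ => by positivity

theorem colSum_nonneg {m n : ℕ} (s : Fin m → Fin n → Fin 2) (j : Fin n) : 0 ≤ colSum s j :=
  Finset.sum_nonneg fun _ _ => by positivity

theorem rowSum_le {m n : ℕ} (s : Fin m → Fin n → Fin 2) (i : Fin m) : rowSum s i ≤ n := by
  have : rowSum s i ≤ ∑ _j : Fin n, (1 : ℤ) := Finset.sum_le_sum fun j _ => by
    have := (s i j).2
    omega
  simpa using this

/-- Splitting `(ℓ^q - column sums, μ)` on the right introduces a second matrix `s'`. Summing over
`s` first reassembles `B_{(ℓ^n, ℓ^q + row sums of s')}`, which vanishes unless `s' = 0`. -/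
theorem rectangle_mul_vertexVec [CharZero K] (t : K) (n q : ℕ) (ℓ : ℤ) (μ : Fin n → ℤ) :
    vertexVec t (Fin.append (fun _ : Fin n => ℓ) (fun _ : Fin q => ℓ)) * vertexVec t μ =
      ∑ s : Fin n → Fin q → Fin 2, weight t s •
        (vertexVec t ((fun _ => ℓ) + rowSum s) *
          vertexVec t (Fin.append ((fun _ => ℓ) - colSum s) μ)) := by
  have e : ∀ s : Fin n → Fin q → Fin 2, weight t s •
        (vertexVec t ((fun _ => ℓ) + rowSum s) *
          vertexVec t (Fin.append ((fun _ => ℓ) - colSum s) μ)) =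
      ∑ s' : Fin q → Fin n → Fin 2, weight t s' • ((weight t s •
        (vertexVec t ((fun _ => ℓ) + rowSum s) *
          vertexVec t (((fun _ => ℓ) + rowSum s') - colSum s))) * vertexVec t (μ - colSum s')) := by
    intro s
    rw [vertexVec_append, Finset.mul_sum, Finset.smul_sum]
    refine Finset.sum_congr rfl fun s' _ => ?_
    rw [mul_smul_comm, smul_comm, smul_mul_assoc, mul_assoc, sub_add_eq_add_sub]
  rw [Finset.sum_congr rfl fun s _ => e s, Finset.sum_comm]
  simp only [← Finset.smul_sum, ← Finset.sum_mul, ← vertexVec_append]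
  rw [Finset.sum_eq_single 0]
  · rw [weight_zero, one_smul, rowSum_zero, colSum_zero, add_zero, sub_zero]
  · intro s' _ hs'
    rw [show ((fun _ => ℓ) + rowSum s') = fun b => ℓ + rowSum s' b from rfl,
      vertexVec_rectangle_append_eq_zero t ℓ (rowSum s') (rowSum_nonneg s') (rowSum_le s')
      (fun hh => hs' (rowSum_eq_zero hh)), zero_mul, smul_zero]
  · simp

/-! ### Alternating functions and the Vandermonde determinant -/

section Vandermonde

variable {n q : ℕ}

/-- The monomial with exponents `a` and `b` in two groups of variables. -/
def mono (K : Type*) [Field K] (a : Fin n → ℕ) (b : Fin q → ℕ) : MvPolynomial (Fin n ⊕ Fin q) K :=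
  (∏ i, X (Sum.inl i) ^ a i) * ∏ j, X (Sum.inr j) ^ b j

theorem mono_mul (a a' : Fin n → ℕ) (b b' : Fin q → ℕ) :
    mono K a b * mono K a' b' = mono K (a + a') (b + b') := by
  simp only [mono, Pi.add_apply, pow_add, Finset.prod_mul_distrib]
  ring

/-- The linear map that sends the monomial with exponents `a`, `b` to `H a b`. -/
def monoEval {M : Type*} [AddCommGroup M] [Module K M] (H : (Fin n → ℕ) → (Fin q → ℕ) → M) :
    MvPolynomial (Fin n ⊕ Fin q) K →ₗ[K] M :=
  (basisMonomials (Fin n ⊕ Fin q) K).constr K fun d => H (fun i => d (Sum.inl i)) fun j => d (Sum.inr j)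

theorem monoEval_mono {M : Type*} [AddCommGroup M] [Module K M]
    (H : (Fin n → ℕ) → (Fin q → ℕ) → M) (a : Fin n → ℕ) (b : Fin q → ℕ) :
    monoEval H (mono K a b) = H a b := by
  have e : mono K a b =
      basisMonomials (Fin n ⊕ Fin q) K (Finsupp.equivFunOnFinite.symm (Sum.elim a b)) := by
    rw [coe_basisMonomials]
    change _ = monomial (Finsupp.equivFunOnFinite.symm (Sum.elim a b)) 1
    rw [monomial_eq, C_1, one_mul, Finsupp.prod_fintype _ _ (by simp),
      Fintype.prod_sum_type]
    rfl
  rw [e, monoEval, Module.Basis.constr_basis]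
  rfl

/-- The exponent of `w_j` is `n` minus a column sum, so lowering by column sums becomes
multiplication by a monomial with nonnegative exponents. -/
theorem prod_sub_eq (t : K) :
    (∏ i : Fin n, ∏ j : Fin q, (X (Sum.inr j) - C t * X (Sum.inl i) :
      MvPolynomial (Fin n ⊕ Fin q) K)) =
    ∑ s : Fin n → Fin q → Fin 2, weight t s •
      mono K (fun i => ∑ j, (s i j : ℕ)) fun j => ∑ i, (1 - (s i j : ℕ)) := by
  have e : ∀ (i : Fin n) (j : Fin q), (X (Sum.inr j) - C t * X (Sum.inl i) :
      MvPolynomial (Fin n ⊕ Fin q) K) =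
      ∑ c : Fin 2, C ((-t) ^ (c : ℕ)) * (X (Sum.inl i) ^ (c : ℕ) * X (Sum.inr j) ^ (1 - (c : ℕ))) := by
    intro i j
    rw [Fin.sum_univ_two]
    simp
    ring
  simp only [e, Fintype.prod_sum]
  refine Finset.sum_congr rfl fun s _ => ?_
  rw [← C_mul', weight]
  simp only [Finset.prod_mul_distrib, mono, map_prod]
  rw [Finset.prod_comm (f := fun (i : Fin n) (j : Fin q) =>
    (X (Sum.inr j) : MvPolynomial (Fin n ⊕ Fin q) K) ^ (1 - (s i j : ℕ)))]
  simp only [Finset.prod_pow_eq_pow_sum]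

theorem det_vandermonde_eq_sum {R : Type*} [CommRing R] {L : ℕ} (v : Fin L → R) :
    (Matrix.vandermonde v).det =
      ∑ σ : Equiv.Perm (Fin L), (Equiv.Perm.sign σ : ℤ) • ∏ i, v i ^ (σ i : ℕ) := by
  rw [← Matrix.det_transpose, Matrix.det_apply]
  rfl

theorem det_vandermonde_eq_prod {R : Type*} [CommRing R] {L : ℕ} (v : Fin L → R) :
    (Matrix.vandermonde v).det = ∏ x : Fin L × Fin L with x.1 < x.2, (v x.2 - v x.1) := by
  rw [Matrix.det_vandermonde, Finset.prod_filter, Fintype.prod_prod_type]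
  refine Finset.prod_congr rfl fun i _ => ?_
  rw [← Finset.filter_lt_eq_Ioi, Finset.prod_filter]

/-- The power of `c` counts the differences within the first group, each of which is scaled by `c`.
-/
theorem det_vandermonde_append {R : Type*} [CommRing R] (c : R) (u : Fin n → R) (w : Fin q → R) :
    (Matrix.vandermonde (Fin.append (fun i => c * u i) w)).det =
      c ^ (Finset.univ.filter fun x : Fin n × Fin n => x.1 < x.2).card *
        ((∏ i, ∏ j, (w j - c * u i)) *
          ((Matrix.vandermonde u).det * (Matrix.vandermonde w).det)) := by
  simp only [det_vandermonde_eq_prod, prod_pairs_add (fun x y =>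
    Fin.append (fun i => c * u i) w y - Fin.append (fun i => c * u i) w x), Fin.append_left,
    Fin.append_right, ← mul_sub, Finset.prod_mul_distrib, Finset.prod_const]
  ring

variable {M : Type*} [AddCommGroup M] [Module K M] {H : (Fin n → ℕ) → (Fin q → ℕ) → M}

/-- The product is symmetric in the `u_i` and in the `w_j`, so multiplying by it keeps the
functional alternating. -/
theorem monoEval_prod_sub_mul (t : K)
    (hH : ∀ (σ : Equiv.Perm (Fin n)) (τ : Equiv.Perm (Fin q)) a b, H (a ∘ σ) (b ∘ τ) =
      ((Equiv.Perm.sign σ : ℤ) * (Equiv.Perm.sign τ : ℤ)) • H a b)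
    (σ : Equiv.Perm (Fin n)) (τ : Equiv.Perm (Fin q)) (a : Fin n → ℕ) (b : Fin q → ℕ) :
    monoEval H ((∏ i : Fin n, ∏ j : Fin q, (X (Sum.inr j) - C t * X (Sum.inl i))) *
        mono K (a ∘ σ) (b ∘ τ)) =
      ((Equiv.Perm.sign σ : ℤ) * (Equiv.Perm.sign τ : ℤ)) •
        monoEval H ((∏ i : Fin n, ∏ j : Fin q, (X (Sum.inr j) - C t * X (Sum.inl i))) *
          mono K a b) := by
  rw [prod_sub_eq, Finset.sum_mul, Finset.sum_mul, map_sum, map_sum, Finset.smul_sum]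
  symm
  refine Fintype.sum_equiv
    (Equiv.arrowCongr σ.symm (Equiv.arrowCongr τ.symm (Equiv.refl _))) _ _ fun s => ?_
  have h1 : (Equiv.arrowCongr σ.symm (Equiv.arrowCongr τ.symm (Equiv.refl (Fin 2)))) s
      = fun i j => s (σ i) (τ j) := rfl
  have h2 : weight t (fun i j => s (σ i) (τ j)) = weight t s := by
    rw [weight, weight, ← Equiv.prod_comp σ fun i => ∏ j, (-t) ^ ((s i j : Fin 2) : ℕ)]
    exact Finset.prod_congr rfl fun i _ => Equiv.prod_comp τ fun j => (-t) ^ ((s (σ i) j : Fin 2) : ℕ)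
  have h3 : (fun i => ∑ j, (s (σ i) (τ j) : ℕ)) = (fun i => ∑ j, (s i j : ℕ)) ∘ σ :=
    funext fun i => Equiv.sum_comp τ fun j => (s (σ i) j : ℕ)
  have h4 : (fun j => ∑ i, (1 - (s (σ i) (τ j) : ℕ))) = (fun j => ∑ i, (1 - (s i j : ℕ))) ∘ τ :=
    funext fun j => Equiv.sum_comp σ fun i => (1 - (s i (τ j) : ℕ))
  rw [h1, h2]
  simp only [h3, h4]
  rw [smul_mul_assoc, smul_mul_assoc, map_smul, map_smul, mono_mul, mono_mul, monoEval_mono,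
    monoEval_mono, smul_comm, ← hH]
  rfl

/-- The value of an alternating functional on `∏ (w_j - t u_i) u^δ w^δ` is a combination of its
values on the monomials whose exponents are a permutation of `0, 1, …, n + q - 1`. -/
theorem sum_weight_mem [CharZero K] {t : K} (ht : t ≠ 0)
    (hH : ∀ (σ : Equiv.Perm (Fin n)) (τ : Equiv.Perm (Fin q)) a b, H (a ∘ σ) (b ∘ τ) =
      ((Equiv.Perm.sign σ : ℤ) * (Equiv.Perm.sign τ : ℤ)) • H a b)
    (N : Submodule K M)
    (hN : ∀ π : Equiv.Perm (Fin (n + q)),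
      H (fun i => π (Fin.castAdd q i)) (fun j => π (Fin.natAdd n j)) ∈ N) :
    ∑ s : Fin n → Fin q → Fin 2, weight t s • H (fun i => ∑ j, (s i j : ℕ) + (Fin.rev i : ℕ))
      (fun j => ∑ i, (1 - (s i j : ℕ)) + (Fin.rev j : ℕ)) ∈ N := by
  set P : MvPolynomial (Fin n ⊕ Fin q) K :=
    ∏ i : Fin n, ∏ j : Fin q, (X (Sum.inr j) - C t * X (Sum.inl i)) with hP
  set E := monoEval H (P * mono K (fun i => (Fin.rev i : ℕ)) (fun j => (Fin.rev j : ℕ))) with hE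
  have h0 : ∑ s : Fin n → Fin q → Fin 2, weight t s • H (fun i => ∑ j, (s i j : ℕ) + (Fin.rev i : ℕ))
      (fun j => ∑ i, (1 - (s i j : ℕ)) + (Fin.rev j : ℕ)) = E := by
    rw [hE, hP, prod_sub_eq, Finset.sum_mul, map_sum]
    refine Finset.sum_congr rfl fun s _ => ?_
    rw [smul_mul_assoc, map_smul, mono_mul, monoEval_mono]
    rfl
  rw [h0]
  clear_value E
  set u : Fin n → MvPolynomial (Fin n ⊕ Fin q) K := fun i => X (Sum.inl i) with hu
  set w : Fin q → MvPolynomial (Fin n ⊕ Fin q) K := fun j => X (Sum.inr j) with hw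
  set ε : ℤ := (Equiv.Perm.sign (Fin.revPerm : Equiv.Perm (Fin n)) : ℤ) *
    (Equiv.Perm.sign (Fin.revPerm : Equiv.Perm (Fin q)) : ℤ) with hε
  -- Each of the `n! q!` terms of the product of the two determinants contributes the same value `ε
  -- E`; the sign `ε` compares increasing exponents with the decreasing staircase.
  have h1 : monoEval H (P * ((Matrix.vandermonde u).det * (Matrix.vandermonde w).det)) =
      ((ε * (n.factorial * q.factorial : ℕ) : ℤ) : K) • E := by
    rw [det_vandermonde_eq_sum, det_vandermonde_eq_sum, Finset.sum_mul_sum, Finset.mul_sum, map_sum]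
    have h2 : ∀ (σ : Equiv.Perm (Fin n)) (τ : Equiv.Perm (Fin q)), monoEval H (P *
        ((Equiv.Perm.sign σ : ℤ) • (∏ i, u i ^ (σ i : ℕ)) *
          (Equiv.Perm.sign τ : ℤ) • (∏ i, w i ^ (τ i : ℕ)))) = ε • E := by
      intro σ τ
      have h3 := monoEval_prod_sub_mul t hH (Fin.revPerm * σ) (Fin.revPerm * τ)
        (fun i => (Fin.rev i : ℕ)) (fun j => (Fin.rev j : ℕ))
      have h4 : mono K ((fun i => (Fin.rev i : ℕ)) ∘ (Fin.revPerm * σ : Equiv.Perm (Fin n)))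
          ((fun j => (Fin.rev j : ℕ)) ∘ (Fin.revPerm * τ : Equiv.Perm (Fin q))) =
          (∏ i, u i ^ (σ i : ℕ)) * ∏ i, w i ^ (τ i : ℕ) := by
        simp only [mono, hu, hw, Function.comp_apply, Equiv.Perm.mul_apply, Fin.revPerm_apply,
          Fin.rev_rev]
      rw [h4, ← hP, ← hE] at h3
      rw [smul_mul_smul_comm, mul_smul_comm, map_zsmul, h3, smul_smul, Equiv.Perm.sign_mul,
        Equiv.Perm.sign_mul]
      congr 1
      rw [hε]
      have hs : ∀ {L : ℕ} (π : Equiv.Perm (Fin L)),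
          (Equiv.Perm.sign π : ℤ) * (Equiv.Perm.sign π : ℤ) = 1 := fun π => by
        rw [← Units.val_mul, Int.units_mul_self, Units.val_one]
      push_cast
      linear_combination (Equiv.Perm.sign (Fin.revPerm : Equiv.Perm (Fin n)) : ℤ) *
        (Equiv.Perm.sign (Fin.revPerm : Equiv.Perm (Fin q)) : ℤ) *
        ((Equiv.Perm.sign τ : ℤ) * (Equiv.Perm.sign τ : ℤ) * hs σ + hs τ)
    simp only [Finset.mul_sum, map_sum, h2, Finset.sum_const, Finset.card_univ, Fintype.card_perm,
      Fintype.card_fin]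
    rw [Int.cast_smul_eq_zsmul, mul_comm ε, smul_smul, ← natCast_zsmul, smul_smul]
  -- The full Vandermonde determinant in `t u_i, w_j` only contains monomials whose exponents are a
  -- permutation of `0, …, n + q - 1`.
  have h2 : monoEval H (Matrix.vandermonde (Fin.append (fun i => C t * u i) w)).det ∈ N := by
    rw [det_vandermonde_eq_sum, map_sum]
    refine Submodule.sum_mem _ fun π _ => ?_
    rw [map_zsmul]
    refine zsmul_mem ?_ _
    have h3 : (∏ i, Fin.append (fun i => C t * u i) w i ^ (π i : ℕ)) =
        (∏ i : Fin n, t ^ (π (Fin.castAdd q i) : ℕ)) •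
          mono K (fun i => π (Fin.castAdd q i)) (fun j => π (Fin.natAdd n j)) := by
      rw [Fin.prod_univ_add]
      simp [mono, hu, hw, mul_pow, Finset.prod_mul_distrib, ← C_mul', mul_assoc]
    rw [h3, map_smul, monoEval_mono]
    exact N.smul_mem _ (hN π)
  rw [det_vandermonde_append, ← hP, ← C_pow, C_mul', map_smul, h1, smul_smul] at h2
  -- `E` is recovered by dividing by a power of `t` and by `± n! q!`; this is where `t ≠ 0` and
  -- characteristic zero enter.
  refine (N.smul_mem_iff (mul_ne_zero (pow_ne_zero _ ht) ?_)).mp h2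
  rw [Int.cast_ne_zero]
  refine mul_ne_zero (mul_ne_zero ?_ ?_) ?_
  · exact (Equiv.Perm.sign _).ne_zero
  · exact (Equiv.Perm.sign _).ne_zero
  · exact_mod_cast mul_ne_zero (Nat.factorial_ne_zero _) (Nat.factorial_ne_zero _)

end Vandermonde

/-! ### The exchange relation in spanning form, and sorting of shifted vectors -/

/-- The exchange sum put in the form of `sum_weight_mem`. The constants `ℓ - n + 1` and `ℓ - (n + q)
+ 1` are what remains of the shifted entries after subtracting the exponents, which include the
staircases `n - 1 - i` and `q - 1 - j`; the entries of `μ` sit at positions `q + c`. -/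
theorem rectangle_vertexVec_mem [CharZero K] {t : K} (ht : t ≠ 0) {n q : ℕ} (ℓ : ℤ) (μ : Fin n → ℤ)
    (f : SymFun K) (N : Submodule K (SymFun K))
    (hN : ∀ π : Equiv.Perm (Fin (n + q)),
      vertexAlt t (fun i : Fin n => ℓ - n + 1 + (π (Fin.castAdd q i) : ℕ))
        (vertexAlt t (Fin.append (fun b : Fin q => ℓ - (n + q) + 1 + (π (Fin.natAdd n b) : ℕ))
          (fun c : Fin n => μ c - c - q)) f) ∈ N) :
    vertexVec t (Fin.append (fun _ : Fin n => ℓ) (fun _ : Fin q => ℓ)) (vertexVec t μ f) ∈ N := by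
  have h1 := LinearMap.congr_fun (rectangle_mul_vertexVec t n q ℓ μ) f
  rw [Module.End.mul_apply, LinearMap.sum_apply] at h1
  rw [h1]
  convert sum_weight_mem (H := fun a b => vertexAlt t (fun i : Fin n => ℓ - n + 1 + a i)
    (vertexAlt t (Fin.append (fun j : Fin q => ℓ - (n + q) + 1 + b j)
      (fun c : Fin n => μ c - c - q)) f)) ht ?_ N hN using 2 with s
  · rw [LinearMap.smul_apply, Module.End.mul_apply]
    have hrev : ∀ {L : ℕ} (i : Fin L), ((Fin.rev i : ℕ) : ℤ) = L - 1 - i := fun i => by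
      rw [Fin.val_rev]; omega
    congr 2
    · rw [vertexAlt]
      refine congrArg _ (funext fun i => ?_)
      push_cast
      rw [hrev, Pi.add_apply, rowSum]
      ring
    · rw [vertexAlt]
      refine congrArg (fun v => vertexVec t v f) (funext fun i => ?_)
      induction i using Fin.addCases with
      | left j =>
        rw [Fin.append_left, Fin.append_left, Fin.val_castAdd, Nat.cast_add, hrev, Pi.sub_apply,
          colSum]
        have h2 : ((∑ i, (1 - (s i j : ℕ)) : ℕ) : ℤ) = n - ∑ i, ((s i j : ℕ) : ℤ) := by
          rw [Nat.cast_sum, Finset.sum_congr rfl fun i _ => Nat.cast_sub (by omega),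
            Finset.sum_sub_distrib]
          simp
        rw [h2]
        ring
      | right c =>
        rw [Fin.append_right, Fin.append_right, Fin.val_natAdd]
        push_cast
        ring
  · intro σ τ a b
    have h2 := append_comp_left (fun j : Fin q => ℓ - (n + q) + 1 + (b j : ℤ))
      (fun c : Fin n => μ c - c - q) τ
    have h3 : (fun i => ℓ - n + 1 + (((a ∘ σ) i : ℕ) : ℤ)) =
      (fun i => ℓ - n + 1 + ((a i : ℕ) : ℤ)) ∘ σ := rfl
    have h4 : (fun j : Fin q => ℓ - (n + q) + 1 + (((b ∘ τ) j : ℕ) : ℤ)) =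
      (fun j => ℓ - (n + q) + 1 + ((b j : ℕ) : ℤ)) ∘ τ := rfl
    rw [h3, h4, ← h2, vertexAlt_comp, vertexAlt_comp, Equiv.Perm.sign_permCongr,
      Equiv.Perm.sign_sumCongr, Equiv.Perm.sign_one, mul_one, LinearMap.smul_apply,
      LinearMap.smul_apply, map_zsmul, smul_smul]

theorem vertexAlt_mem_of_sorted [CharZero K] (t : K) {L : ℕ} (x : Fin L → ℤ) (f : SymFun K)
    (N : Submodule K (SymFun K))
    (H : ∀ σ : Equiv.Perm (Fin L), StrictAnti (x ∘ σ) → vertexAlt t (x ∘ σ) f ∈ N) :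
    vertexAlt t x f ∈ N := by
  by_cases hx : Function.Injective x
  · have h1 : StrictMono (x ∘ Tuple.sort x) :=
      (Tuple.monotone_sort x).strictMono_of_injective (hx.comp (Tuple.sort x).injective)
    have h2 : StrictAnti (x ∘ (Tuple.sort x * Fin.revPerm : Equiv.Perm (Fin L))) :=
      fun i j hij => h1 (Fin.rev_lt_rev.mpr hij)
    have h3 := H _ h2
    rw [vertexAlt_comp, LinearMap.smul_apply] at h3
    rcases Int.units_eq_one_or (Equiv.Perm.sign (Tuple.sort x * Fin.revPerm)) with h | h
    · simpa [h] using h3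
    · rw [h] at h3
      simpa using h3
  · obtain ⟨i, j, hxy, hij⟩ : ∃ i j, x i = x j ∧ i ≠ j := by
      simpa [Function.Injective] using hx
    rw [vertexAlt_eq_zero t x hij hxy]
    exact N.zero_mem

theorem antitone_add_of_strictAnti {L : ℕ} {x : Fin L → ℤ} (hx : StrictAnti x) :
    Antitone fun i : Fin L => x i + i := by
  have key : ∀ d : ℕ, ∀ i j : Fin L, (j : ℕ) = i + d → x j + j ≤ x i + i := by
    intro d
    induction d with
    | zero => intro i j hij; rw [Fin.ext (a := j) (b := i) (by omega)]
    | succ d ih =>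
      intro i j hij
      have h1 := ih i ⟨i + d, by omega⟩ rfl
      have h2 : x j < x ⟨i + d, by omega⟩ := hx (by rw [Fin.lt_def]; simp only; omega)
      simp only at h1
      push_cast at h1
      omega
  intro i j hij
  have h3 : (i : ℕ) ≤ j := hij
  exact key (j - i) i j (by omega)

/-! ### The operators of partitions and the spaces `Ω` -/

theorem vertexPart_eq (t : K) (l : List ℕ) (L : ℕ) (hL : l.length = L) :
    vertexPart t l = vertexVec t fun i : Fin L => (l.get (i.cast hL.symm) : ℤ) := by
  subst hL
  rfl

theorem vertexPart_ofFn (t : K) {L : ℕ} (v : Fin L → ℕ) :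
    vertexPart t (List.ofFn v) = vertexVec t fun i => (v i : ℤ) := by
  rw [vertexPart_eq t _ L List.length_ofFn]
  simp

theorem vertexPart_replicate (t : K) (L a : ℕ) :
    vertexPart t (List.replicate L a) = vertexVec t fun _ : Fin L => (a : ℤ) := by
  rw [vertexPart_eq t _ L List.length_replicate]
  simp

/-- A nonzero matrix lowers the last entry below `0`, and `B_{-c} · 1 = h_{-c} = 0` for `c > 0`. -/
theorem vertexPart_append_zero [CharZero K] (t : K) (l : List ℕ) :
    vertexPart t (l ++ [0]) (1 : SymFun K) = vertexPart t l 1 := by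
  have e : (fun i : Fin (l.length + 1) => ((l ++ [0]).get (i.cast (by simp)) : ℤ)) =
      Fin.append (fun i : Fin l.length => (l.get i : ℤ)) (fun _ : Fin 1 => (0 : ℤ)) := by
    refine funext fun i => ?_
    induction i using Fin.addCases <;> simp
  rw [vertexPart_eq t (l ++ [0]) (l.length + 1) (by simp), e, vertexVec_append,
    LinearMap.sum_apply, Finset.sum_eq_single 0]
  · rw [LinearMap.smul_apply, Module.End.mul_apply, weight_zero, one_smul, rowSum_zero, colSum_zero,
      add_zero, sub_zero, vertexVec_one_entry, vertex_one, h_zero]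
    rfl
  · intro s _ hs
    have h1 : 0 < colSum s 0 := by
      refine lt_of_le_of_ne (colSum_nonneg s 0) fun h0 => hs ?_
      rw [colSum, eq_comm, Finset.sum_eq_zero_iff_of_nonneg (fun _ _ => by positivity)] at h0
      refine funext fun i => funext fun j => ?_
      have := h0 i (Finset.mem_univ i)
      rw [Subsingleton.elim j 0]
      ext
      simpa using this
    rw [LinearMap.smul_apply, Module.End.mul_apply, vertexVec_one_entry, vertex_one, h_of_neg,
      map_zero, smul_zero]
    rw [Pi.sub_apply]
    omega
  · simp

theorem vertexPart_append_replicate_zero [CharZero K] (t : K) (l : List ℕ) (r : ℕ) :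
    vertexPart t (l ++ List.replicate r 0) (1 : SymFun K) = vertexPart t l 1 := by
  induction r with
  | zero => simp
  | succ r ih => rw [List.replicate_succ', ← List.append_assoc, vertexPart_append_zero, ih]

theorem exists_eq_append_replicate_zero (l : List ℕ) (hl : l.Pairwise (· ≥ ·)) :
    ∃ (l' : List ℕ) (r : ℕ), l = l' ++ List.replicate r 0 ∧ ∀ x ∈ l', 0 < x := by
  induction l with
  | nil => exact ⟨[], 0, by simp⟩
  | cons a l ih =>
    rw [List.pairwise_cons] at hl
    rcases Nat.eq_zero_or_pos a with rfl | ha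
    · refine ⟨[], l.length + 1, ?_, by simp⟩
      rw [List.nil_append, List.replicate_succ, List.cons_inj_right, List.eq_replicate_iff]
      exact ⟨rfl, fun b hb => Nat.le_zero.mp (hl.1 b hb)⟩
    · obtain ⟨l', r, hlr, hpos⟩ := ih hl.2
      refine ⟨a :: l', r, by rw [hlr]; rfl, fun x hx => ?_⟩
      rcases List.mem_cons.mp hx with rfl | hx
      · exact ha
      · exact hpos x hx

theorem splitPoly_cons (t : K) (k a : ℕ) (l : List ℕ) :
    splitPoly t k (a :: l) =
      vertexPart t (a :: l.take (k - a)) (splitPoly t k (l.drop (k - a))) := by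
  rw [splitPoly, kSplit]
  rfl

theorem splitPoly_nil (t : K) (k : ℕ) : splitPoly t k [] = 1 := by
  rw [splitPoly, kSplit]
  rfl

theorem splitPoly_mem (t : K) (k : ℕ) {l : List ℕ} (hl : IsPartition l) :
    splitPoly t k l ∈ Omega t k (firstPart l) :=
  Submodule.subset_span ⟨l, hl, rfl, rfl⟩

theorem firstPart_ge {l : List ℕ} (hl : l.Pairwise (· ≥ ·)) : ∀ x ∈ l, x ≤ firstPart l := by
  intro x hx
  cases l with
  | nil => simp at hx
  | cons a l =>
    rcases List.mem_cons.mp hx with rfl | hx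
    · exact le_rfl
    · exact (List.pairwise_cons.mp hl).1 x hx

/-- A block with `k + 1 - j` parts and first part `j` has main hook-length `k`, so placing it before
a partition with first part `i`, at most its last part, makes it the first block of the `k`-split.
-/
theorem vertexPart_mem_Omega [CharZero K] (t : K) {k j i : ℕ} (hj : 1 ≤ j) (hjk : j ≤ k)
    {l : List ℕ} (hlen : l.length = k + 1 - j) (hl : l.Pairwise (· ≥ ·)) (hfirst : firstPart l = j)
    (hi : ∀ x ∈ l, i ≤ x) {f : SymFun K} (hf : f ∈ Omega t k i) :
    vertexPart t l f ∈ Omega t k j := by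
  rw [Omega] at hf
  induction hf using Submodule.span_induction with
  | zero => rw [map_zero]; exact Submodule.zero_mem _
  | add f g _ _ hf hg => rw [map_add]; exact Submodule.add_mem _ hf hg
  | smul c f _ hf => rw [map_smul]; exact Submodule.smul_mem _ c hf
  | mem f hf =>
    obtain ⟨m, hm, hmi, rfl⟩ := hf
    -- For `i = 0` the block may end in zeros; it then acts on `1` and the zeros can be dropped,
    -- leaving a single block.
    rcases Nat.eq_zero_or_pos i with rfl | hi0
    · have hm0 : m = [] := by
        cases m with
        | nil => rfl
        | cons a m =>
          have := hm.2 a (by simp)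
          simp only [firstPart, List.headD_cons] at hmi
          omega
      obtain ⟨l', r, rfl, hpos⟩ := exists_eq_append_replicate_zero l hl
      rw [hm0, splitPoly_nil, vertexPart_append_replicate_zero]
      have hpart : IsPartition l' := ⟨(List.pairwise_append.mp hl).1, hpos⟩
      cases l' with
      | nil =>
        cases r with
        | zero => simp [firstPart] at hfirst; omega
        | succ r => simp [firstPart, List.replicate_succ] at hfirst; omega
      | cons a l' =>
        have ha : a = j := hfirst
        have hle : l'.length ≤ k - a := by
          simp only [List.length_append, List.length_cons, List.length_replicate] at hlen
          omega
        have h1 := splitPoly_mem t k hpart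
        rwa [splitPoly_cons, List.take_of_length_le hle, List.drop_of_length_le hle, splitPoly_nil,
          show firstPart (a :: l') = j from ha] at h1
    · have hpart : IsPartition (l ++ m) := by
        refine ⟨List.pairwise_append.mpr ⟨hl, hm.1, fun a ha b hb => ?_⟩, fun x hx => ?_⟩
        · exact (firstPart_ge hm.1 b hb).trans (hmi ▸ hi a ha)
        · rcases List.mem_append.mp hx with hx | hx
          · exact hi0.trans_le (hi x hx)
          · exact hm.2 x hx
      cases l with
      | nil => simp at hlen; omega
      | cons a l =>
        have ha : a = j := hfirst
        have hle : l.length = k - a := by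
          simp only [List.length_cons] at hlen
          omega
        have h1 := splitPoly_mem t k hpart
        rwa [List.cons_append, splitPoly_cons, List.take_left' hle, List.drop_left' hle,
          show firstPart (a :: (l ++ m)) = j from ha] at h1

/-- After sorting, the largest shifted entry is the first part, namely `j`, and the smallest sits in
position `L - 1`, so the lower bound says that the last part is at least `i`. -/
theorem vertexAlt_mem_Omega [CharZero K] (t : K) {k j i L : ℕ} (hj : 1 ≤ j) (hjk : j ≤ k)
    (hL : L = k + 1 - j) {x : Fin L → ℤ} (hx : ∀ a, x a ≤ j) (hx' : ∃ a, x a = j)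
    (hi : ∀ a, (i : ℤ) - (L - 1) ≤ x a) {f : SymFun K} (hf : f ∈ Omega t k i) :
    vertexAlt t x f ∈ Omega t k j := by
  refine vertexAlt_mem_of_sorted t x f _ fun σ hσ => ?_
  have hanti := antitone_add_of_strictAnti hσ
  have hL0 : 0 < L := by omega
  have hge : ∀ a : Fin L, (i : ℤ) ≤ (x ∘ σ) a + a := fun a => by
    have h1 := hanti (show a ≤ ⟨L - 1, by omega⟩ by rw [Fin.le_def]; simp only; omega)
    have h2 := hi (σ ⟨L - 1, by omega⟩)
    simp only [Function.comp_apply] at h1 ⊢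
    omega
  have hcast : ∀ a : Fin L, ((((x ∘ σ) a + a).toNat : ℕ) : ℤ) = (x ∘ σ) a + a := fun a =>
    Int.toNat_of_nonneg (by have := hge a; omega)
  have e : vertexAlt t (x ∘ σ) = vertexPart t (List.ofFn fun a => ((x ∘ σ) a + a).toNat) := by
    rw [vertexPart_ofFn, vertexAlt]
    simp only [hcast]
  rw [e]
  refine vertexPart_mem_Omega t hj hjk (by rw [List.length_ofFn, hL]) ?_ ?_ ?_ hf
  · rw [List.pairwise_ofFn]
    exact fun a b hab => Int.toNat_le_toNat (hanti hab.le)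
  · obtain ⟨a, ha⟩ := hx'
    obtain ⟨M, rfl⟩ : ∃ M, L = M + 1 := ⟨L - 1, by omega⟩
    have h1 : x (σ (σ.symm a)) ≤ x (σ 0) := hσ.antitone (Fin.zero_le _)
    rw [Equiv.apply_symm_apply, ha] at h1
    have h2 := hx (σ 0)
    rw [List.ofFn_succ, firstPart, List.headD_cons, Function.comp_apply, le_antisymm h2 h1]
    simp
  · intro y hy
    rw [List.mem_ofFn] at hy
    obtain ⟨a, rfl⟩ := hy
    have := hge a
    omega

/-! ### The rectangle against a block with larger first part, and the induction -/

theorem rectangle_mem_Omega_of_lt [CharZero K] {t : K} (ht : t ≠ 0) {k j ℓ i : ℕ} (hℓ : 1 ≤ ℓ)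
    (hℓj : ℓ < j) (hjk : j ≤ k) {μ : List ℕ} (hlen : μ.length = k + 1 - j)
    (hfirst : firstPart μ = j) (hμ : μ.Pairwise (· ≥ ·)) (hi : ∀ x ∈ μ, i ≤ x)
    {f : SymFun K} (hf : f ∈ Omega t k i)
    (hR : vertexPart t (List.replicate (k + 1 - ℓ) ℓ) f ∈ Omega t k (max i ℓ)) :
    vertexPart t (List.replicate (k + 1 - ℓ) ℓ) (vertexPart t μ f) ∈ Omega t k j := by
  obtain ⟨n, hn⟩ : ∃ n, n = k + 1 - j := ⟨_, rfl⟩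
  -- The rectangle has `k + 1 - ℓ = n + q` rows: as many as `μ` has parts, and `q` more.
  obtain ⟨q, hq⟩ : ∃ q, q = j - ℓ := ⟨_, rfl⟩
  have hm : k + 1 - ℓ = n + q := by omega
  have hn0 : 0 < n := by omega
  rw [hm, vertexPart_replicate] at hR ⊢
  rw [vertexPart_eq t μ n (hlen.trans hn.symm)]
  have hrect : (fun _ : Fin (n + q) => (ℓ : ℤ)) = Fin.append (fun _ => (ℓ : ℤ)) (fun _ => (ℓ : ℤ)) := by
    refine funext fun a => ?_
    induction a using Fin.addCases <;> simp
  set v : Fin n → ℤ := fun a => (μ.get (a.cast (hlen.trans hn.symm).symm) : ℤ) with hv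
  have hv0 : v ⟨0, hn0⟩ = j := by
    cases μ with
    | nil => simp at hlen; omega
    | cons a μ => rw [← hfirst]; rfl
  have hvj : ∀ c, v c ≤ j := fun c => by
    have := firstPart_ge hμ _ (List.get_mem μ (c.cast (hlen.trans hn.symm).symm))
    rw [hfirst] at this
    exact Nat.cast_le.mpr this
  have hvi : ∀ c, (i : ℤ) ≤ v c := fun c => by
    exact Nat.cast_le.mpr <| hi _ (List.get_mem μ (c.cast (hlen.trans hn.symm).symm))
  have hvmono : ∀ c d : Fin n, c ≤ d → v d ≤ v c := fun c d hcd => by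
    rcases hcd.eq_or_lt with rfl | hlt
    · exact le_rfl
    · exact Nat.cast_le.mpr <| List.pairwise_iff_get.mp hμ
        (c.cast (hlen.trans hn.symm).symm) (d.cast (hlen.trans hn.symm).symm) hlt
  clear_value v
  rw [hrect]
  refine rectangle_vertexVec_mem ht _ _ _ _ fun π => ?_
  set y : Fin (q + n) → ℤ := Fin.append
    (fun b : Fin q => (ℓ : ℤ) - (n + q) + 1 + (π (Fin.natAdd n b) : ℕ)) (fun c : Fin n => v c - c - q)
    with hy
  have hyl : ∀ b, y (Fin.castAdd n b) = (ℓ : ℤ) - (n + q) + 1 + (π (Fin.natAdd n b) : ℕ) :=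
    fun b => Fin.append_left _ _ b
  have hyr : ∀ c, y (Fin.natAdd q c) = v c - c - q := fun c => Fin.append_right _ _ c
  clear_value y
  by_cases hinj : Function.Injective y
  swap
  · obtain ⟨a, b, hab, hne⟩ : ∃ a b, y a = y b ∧ a ≠ b := by
      simpa [Function.Injective] using hinj
    rw [vertexAlt_eq_zero t y hne hab, LinearMap.zero_apply, map_zero]
    exact Submodule.zero_mem _
  -- The first part of `μ`, moved `q` places to the right, has shifted entry `j - q = ℓ`, the
  -- largest entry possible in `y`.
  have hy0 : y (Fin.natAdd q ⟨0, hn0⟩) = ℓ := by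
    rw [hyr, hv0]
    simp only
    omega
  have hyle : ∀ a, y a ≤ ℓ := fun a => by
    induction a using Fin.addCases with
    | left b =>
      rw [hyl]
      have := (π (Fin.natAdd n b)).2
      omega
    | right c =>
      rw [hyr]
      have := hvj c
      omega
  -- If `π` took its top value in the second group, `y` would contain `ℓ` twice. So the top value
  -- occurs in the left factor, where it gives the shifted entry `ℓ + q = j`.
  have htop : ∃ a : Fin n, (π (Fin.castAdd q a) : ℕ) = n + q - 1 := by
    obtain ⟨a, ha⟩ : ∃ a, π a = ⟨n + q - 1, by omega⟩ := π.surjective _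
    induction a using Fin.addCases with
    | left a => exact ⟨a, by rw [ha]⟩
    | right b =>
      have h1 : y (Fin.castAdd n b) = y (Fin.natAdd q ⟨0, hn0⟩) := by
        rw [hy0, hyl, ha]
        simp only
        omega
      have h2 := congrArg Fin.val (hinj h1)
      rw [Fin.val_castAdd, Fin.val_natAdd] at h2
      omega
  obtain ⟨i', hyi, hxi⟩ : ∃ i' : ℕ, vertexAlt t y f ∈ Omega t k i' ∧ ∀ a : Fin n,
      (i' : ℤ) - (n - 1) ≤ (ℓ : ℤ) - n + 1 + (π (Fin.castAdd q a) : ℕ) := by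
    -- If all parts of `μ` are at least `ℓ`, the distinct entries of `y` fill an interval of `n + q`
    -- integers, so the right factor is `±B_R` and `hR` applies, with `i' = max i ℓ`. Otherwise `i <
    -- ℓ`, and the right factor is itself an admissible block with first part `ℓ`, so `i' = ℓ`.
    by_cases hvl : ∀ c, (ℓ : ℤ) ≤ v c
    · have hyge : ∀ a, (ℓ : ℤ) - (n + q - 1) ≤ y a := fun a => by
        induction a using Fin.addCases with
        | left b => rw [hyl]; omega
        | right c => rw [hyr]; have := hvl c; omega
      refine ⟨max i ℓ, vertexAlt_mem_of_sorted t y f _ fun σ hσ => ?_, fun a => ?_⟩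
      · have hanti := antitone_add_of_strictAnti hσ
        have h1 : vertexAlt t (y ∘ σ) = vertexVec t fun _ : Fin (n + q) => (ℓ : ℤ) := by
          have h2 : (fun a : Fin (q + n) => (y ∘ σ) a + a) = fun _ => (ℓ : ℤ) := by
            refine funext fun a => ?_
            have h3 := hanti (show a ≤ ⟨q + n - 1, by omega⟩ by rw [Fin.le_def]; simp only; omega)
            have h4 := hanti (show ⟨0, by omega⟩ ≤ a by rw [Fin.le_def]; simp only; omega)
            have h5 := hyge (σ ⟨q + n - 1, by omega⟩)
            have h6 := hyle (σ ⟨0, by omega⟩)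
            simp only [Function.comp_apply] at h3 h4 ⊢
            omega
          rw [vertexAlt, h2, add_comm q n]
        rw [h1]
        exact hR
      -- Since `y` fills the interval, each value of `π` in the left group matches an entry of `y`.
      -- By injectivity of `π` that entry comes from `μ`, so the shifted entry in the left factor
      -- equals some `v_c - c`, which is at least `max i ℓ - (n - 1)`.
      · have hsurj : ∃ c, y c = (ℓ : ℤ) - (n + q) + 1 + (π (Fin.castAdd q a) : ℕ) := by
          let g : Fin (q + n) → Fin (q + n) := fun c => ⟨(y c - (ℓ - (n + q - 1))).toNat, by
            have h1 := hyge c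
            have h2 := hyle c
            omega⟩
          have hg : Function.Injective g := fun c d hcd => hinj (by
            have h1 := hyge c
            have h2 := hyge d
            have h3 := congrArg Fin.val hcd
            simp only [g] at h3
            omega)
          obtain ⟨c, hc⟩ := Finite.surjective_of_injective hg
            ⟨(π (Fin.castAdd q a) : ℕ), by have := (π (Fin.castAdd q a)).2; omega⟩
          refine ⟨c, ?_⟩
          have h1 := hyge c
          have h3 := congrArg Fin.val hc
          simp only [g] at h3
          omega
        obtain ⟨c, hc⟩ := hsurj
        induction c using Fin.addCases with
        | left b =>
          rw [hyl] at hc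
          have h1 : π (Fin.natAdd n b) = π (Fin.castAdd q a) := Fin.ext (by omega)
          have h2 := congrArg Fin.val (π.injective h1)
          rw [Fin.val_castAdd, Fin.val_natAdd] at h2
          omega
        | right c =>
          rw [hyr] at hc
          have h1 := hvi c
          have h2 := c.2
          rw [Nat.cast_max]
          have h3 : max (i : ℤ) ℓ = i ∨ max (i : ℤ) ℓ = ℓ := max_choice _ _
          omega
    · push Not at hvl
      obtain ⟨c, hc⟩ := hvl
      refine ⟨ℓ, vertexAlt_mem_Omega t hℓ (by omega) (by omega) hyle ⟨_, hy0⟩ (fun a => ?_) hf,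
        fun a => by omega⟩
      have h1 := hvi c
      induction a using Fin.addCases with
      | left b => rw [hyl]; push_cast; omega
      | right d =>
        rw [hyr]
        have h2 := hvi d
        have h3 := d.2
        push_cast
        omega
  refine vertexAlt_mem_Omega t (by omega) hjk hn (fun a => ?_) ?_ hxi hyi
  · have := (π (Fin.castAdd q a)).2
    omega
  · obtain ⟨a, ha⟩ := htop
    exact ⟨a, by rw [ha]; omega⟩

/-- The induction is on the number of parts: if `λ₁ > ℓ`, the first block is removed and the
statement for the rest is what the exchange step needs when it reproduces the rectangle. -/
theorem rectangle_splitPoly_mem [CharZero K] {t : K} (ht : t ≠ 0) {k ℓ : ℕ} (hℓ : 1 ≤ ℓ)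
    (hℓk : ℓ ≤ k) (l : List ℕ) (hl : IsPartition l) (hlk : firstPart l ≤ k) :
    vertexPart t (List.replicate (k + 1 - ℓ) ℓ) (splitPoly t k l) ∈
      Omega t k (max (firstPart l) ℓ) := by
  induction hlen : l.length using Nat.strong_induction_on generalizing l with
  | _ N ih =>
  subst hlen
  rcases le_or_gt (firstPart l) ℓ with hle | hlt
  · rw [max_eq_right hle]
    refine vertexPart_mem_Omega t hℓ hℓk List.length_replicate ?_ ?_ ?_ (splitPoly_mem t k hl)
    · rw [List.pairwise_replicate]; right; exact le_rfl
    · rw [firstPart, show k + 1 - ℓ = k - ℓ + 1 by omega, List.replicate_succ, List.headD_cons]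
    · intro x hx
      rwa [List.eq_of_mem_replicate hx]
  · cases l with
    | nil => simp [firstPart] at hlt
    | cons a l =>
      have ha : firstPart (a :: l) = a := rfl
      rw [ha] at hlt hlk ⊢
      rw [max_eq_left hlt.le]
      have hsplit : a :: l = (a :: l.take (k - a)) ++ l.drop (k - a) := by simp
      have hpw := hl.1
      rw [hsplit, List.pairwise_append] at hpw
      have hrest : IsPartition (l.drop (k - a)) :=
        ⟨hpw.2.1, fun x hx => hl.2 x (List.mem_cons_of_mem _ (List.mem_of_mem_drop hx))⟩
      have hfirst : ∀ x ∈ a :: l.take (k - a), firstPart (l.drop (k - a)) ≤ x := by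
        intro x hx
        cases hd : l.drop (k - a) with
        | nil => simp [firstPart]
        | cons b d => exact hpw.2.2 x hx b (by rw [hd]; simp)
      have hIH := ih (l.drop (k - a)).length (by simp) (l.drop (k - a)) hrest
        ((hfirst a (by simp)).trans hlk) rfl
      rw [splitPoly_cons]
      rcases le_or_gt (k - a) l.length with hfull | hshort
      · exact rectangle_mem_Omega_of_lt ht hℓ hlt hlk
          (by rw [List.length_cons, List.length_take]; omega) rfl hpw.1 hfirst
          (splitPoly_mem t k hrest) hIH
      · rw [List.drop_of_length_le hshort.le] at hIH ⊢
        rw [splitPoly_nil] at hIH ⊢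
        -- The only block may be too short for the exchange step, so it is padded with zeros to `k +
        -- 1 - a` parts; it acts on `1`, which lies in `Ω_0`, whence `i = 0`.
        rw [← vertexPart_append_replicate_zero t _ (k - a - l.length)]
        refine rectangle_mem_Omega_of_lt (i := 0) ht hℓ hlt hlk ?_ rfl ?_ (by simp) ?_ hIH
        · rw [List.length_append, List.length_cons, List.length_take, List.length_replicate]
          omega
        · rw [List.pairwise_append]
          refine ⟨hpw.1, ?_, fun x _ y hy => ?_⟩
          · rw [List.pairwise_replicate]; right; exact le_rfl
          · rw [List.eq_of_mem_replicate hy]; exact Nat.zero_le x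
        · have := splitPoly_mem t k (l := []) ⟨List.Pairwise.nil, by simp⟩
          rwa [splitPoly_nil] at this

end KSplit

end

theorem theorem2 (k j ℓ : ℕ) (hj : j ≤ k) (hℓ : 1 ≤ ℓ) (hℓk : ℓ ≤ k)
    (f : KSplit.SymFun (RatFunc ℚ)) (hf : f ∈ KSplit.Omega (RatFunc.X : RatFunc ℚ) k j) :
    KSplit.vertexPart (RatFunc.X : RatFunc ℚ) (List.replicate (k + 1 - ℓ) ℓ) f ∈
      KSplit.Omega (RatFunc.X : RatFunc ℚ) k (max j ℓ) := by
  rw [KSplit.Omega] at hf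
  induction hf using Submodule.span_induction with
  | zero => rw [map_zero]; exact Submodule.zero_mem _
  | add f g _ _ hf hg => rw [map_add]; exact Submodule.add_mem _ hf hg
  | smul c f _ hf => rw [map_smul]; exact Submodule.smul_mem _ c hf
  | mem f hf =>
    obtain ⟨l, hl, rfl, rfl⟩ := hf
    exact KSplit.rectangle_splitPoly_mem RatFunc.X_ne_zero hℓ hℓk l hl hj
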